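/- Let $\mathbb{H}$ be the upper half plane, $q=e^{2\pi i\tau}$, $y=e^{2\pi i z}$, let $$\theta_1(\tau,z)=i\,q^{1/8}y^{-1/2}\prod_{m\ge1}(1-q^m)(1-yq^{m-1})(1-y^{-1}q^m),$$ with $q^{1/8}=e^{\pi i\tau/4}$ and $y^{-1/2}=e^{-\pi i z}$, let $\eta$ be the Dedekind eta function, and let $\wp(\tau,z)$ be the Weierstrass $\wp$-function of the lattice $\mathbb{Z}+\mathbb{Z}\tau$. For an integer $r\ge1$ the equivariant elliptic genus of the ALE space $X_r$ of type $A_{r-1}$ is $$Z_{X_r}(\tau,z;t_1,t_2)=\sum_{j=0}^{r-1}\frac{\theta_1(\tau,z-(j+1)t_1+(r-j-1)t_2)}{\theta_1(\tau,-(j+1)t_1+(r-j-1)t_2)}\cdot\frac{\theta_1(\tau,z+jt_1+(j-r)t_2)}{\theta_1(\tau,jt_1+(j-r)t_2)} .$$ The elliptic genus of a compact complex surface $S$ with Chern roots $x_1,x_2$ is $\int_S Q(x_1)Q(x_2)$, where $Q(x)=x\,\theta_1(\tau,z+\tfrac{x}{2\pi i})/\theta_1(\tau,\tfrac{x}{2\pi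 i})$; it depends only on the Chern numbers $c_1^2,c_2$ of $S$. Write $Z_{K3}(\tau,z)$ for the elliptic genus of a K3 surface ($c_1^2=0$, $c_2=24$). A weak Jacobi form of weight $k$ and index $m$ is a holomorphic function $\varphi:\mathbb{H}\times\mathbb{C}\to\mathbb{C}$ such that $$\varphi\Bigl(\tfrac{a\tau+b}{c\tau+d},\tfrac{z}{c\tau+d}\Bigr)=(c\tau+d)^k e^{2\pi i m c z^2/(c\tau+d)}\varphi(\tau,z)$$ for all $\begin{pmatrix}a&b\\c&d\end{pmatrix}\in SL_2(\mathbb{Z})$, $\varphi(\tau,z+\lambda\tau+\mu)=e^{-2\pi i m(\lambda^2\tau+2\lambda z)}\varphi(\tau,z)$ for all $\lambda,\mu\in\mathbb{Z}$, and $\varphi$ has a Fourier expansion $\sum_{n\ge0,\ l\in\mathbb{Z}}c(n,l)q^ny^l$. Claim. Let $r\ge1$. 1. For all $\tau\in\mathbb{H}$ and $z\in\mathbb{C}$ the limit $$Z^{reg}_{X_r}(\tau,z):=\lim_{t\to0}\left(Z_{X_r}(\tau,z;t,-t)-\frac{-1}{(2\pi t)^2r}\left(\frac{\theta_1(\tau,z)}{\eta(\tau)^3}\right)^2\right)$$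 exists, where $t$ runs through the nonzero complex numbers. 2. For all $\tau\in\mathbb{H}$ and $z\in\mathbb{C}\setminus(\mathbb{Z}+\mathbb{Z}\tau)$, $$Z^{reg}_{X_r}(\tau,z)=\frac{r}{(2\pi)^2}\left(\frac{\theta_1(\tau,z)}{\eta(\tau)^3}\right)^2\wp(\tau,z).$$ 3. $Z^{reg}_{X_r}$ is a weak Jacobi form of weight $0$ and index $1$. 4. $Z^{reg}_{X_r}$ is a constant multiple of the elliptic genus of a K3 surface; precisely, $Z^{reg}_{X_r}(\tau,z)=\frac{r}{24}\,Z_{K3}(\tau,z)$ for all $\tau\in\mathbb{H}$ and $z\in\mathbb{C}$. -/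

import Mathlib

open Complex Filter Topology
open UpperHalfPlane hiding I
open scoped Real MatrixGroups

noncomputable section

namespace ALEGenus

/-- The Jacobi theta function
`θ₁(τ, z) = i q^{1/8} y^{-1/2} ∏_{m ≥ 1} (1 - q^m) (1 - y q^{m-1}) (1 - y⁻¹ q^m)`,
with `q = exp (2 π i τ)` and `y = exp (2 π i z)`; the product index is shifted to start at `0`. -/
def theta1 (τ : ℍ) (z : ℂ) : ℂ :=
  I * cexp (2 * π * I * τ / 8) * cexp (-(π * I * z)) *
    ∏' m : ℕ, ((1 - cexp (2 * π * I * τ) ^ (m + 1)) *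
      (1 - cexp (2 * π * I * z) * cexp (2 * π * I * τ) ^ m) *
      (1 - (cexp (2 * π * I * z))⁻¹ * cexp (2 * π * I * τ) ^ (m + 1)))

/-- First weight of the tangent representation of `X_r` at the torus fixed point `p_j`. -/
def weightX (r j : ℕ) (t₁ t₂ : ℂ) : ℂ := -((j : ℂ) + 1) * t₁ + ((r : ℂ) - j - 1) * t₂

/-- Second weight of the tangent representation of `X_r` at the torus fixed point `p_j`. -/
def weightY (r j : ℕ) (t₁ t₂ : ℂ) : ℂ := (j : ℂ) * t₁ + ((j : ℂ) - r) * t₂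

/-- The equivariant elliptic genus `Z_{X_r}(τ, z; t₁, t₂)` of the ALE space `X_r` of type
`A_{r-1}`: the sum of the contributions of the fixed points `p_0, …, p_{r-1}`. -/
def equivariantEllipticGenus (r : ℕ) (τ : ℍ) (z t₁ t₂ : ℂ) : ℂ :=
  ∑ j ∈ Finset.range r,
    theta1 τ (z + weightX r j t₁ t₂) / theta1 τ (weightX r j t₁ t₂) *
      (theta1 τ (z + weightY r j t₁ t₂) / theta1 τ (weightY r j t₁ t₂))

/-- The singular part `-(1 / ((2 π t)² r)) (θ₁(τ, z) / η(τ)³)²` of `Z_{X_r}(τ, z; t, -t)`. -/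
def singularTerm (r : ℕ) (τ : ℍ) (z t : ℂ) : ℂ :=
  -1 / ((2 * π * t) ^ 2 * r) * (theta1 τ z / ModularForm.eta (τ : ℂ) ^ 3) ^ 2

/-- The regularized elliptic genus: the limit, as `t → 0` (`t ≠ 0` complex), of
`Z_{X_r}(τ, z; t, -t)` minus its singular part. -/
def regularizedEllipticGenus (r : ℕ) (τ : ℍ) (z : ℂ) : ℂ :=
  limUnder (𝓝[≠] (0 : ℂ)) fun t : ℂ =>
    equivariantEllipticGenus r τ z t (-t) - singularTerm r τ z t

/-- The periods `1, τ`. -/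
def periods (τ : ℍ) : PeriodPair where
  ω₁ := 1
  ω₂ := τ
  indep := by
    rw [LinearIndependent.pair_iff]
    intro s t h
    have him := congrArg Complex.im h
    have hre := congrArg Complex.re h
    have ht : t = 0 := by
      simpa [τ.im_ne_zero] using him
    subst ht
    simpa using hre

/-- Weak Jacobi forms of weight `k` and index `m` for the full Jacobi group. -/
structure IsWeakJacobiForm (k : ℤ) (m : ℕ) (φ : ℍ → ℂ → ℂ) : Prop where
  /-- `φ` is jointly holomorphic on `ℍ × ℂ`. -/
  holomorphic : DifferentiableOn ℂ (fun p : ℂ × ℂ => φ (UpperHalfPlane.ofComplex p.1) p.2)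
    {p : ℂ × ℂ | 0 < p.1.im}
  modular : ∀ (γ : SL(2, ℤ)) (τ : ℍ) (z : ℂ),
    φ (γ • τ) (z / ((γ 1 0 : ℤ) * (τ : ℂ) + (γ 1 1 : ℤ))) =
      ((γ 1 0 : ℤ) * (τ : ℂ) + (γ 1 1 : ℤ)) ^ k *
        cexp (2 * π * I * m * (γ 1 0 : ℤ) * z ^ 2 /
          ((γ 1 0 : ℤ) * (τ : ℂ) + (γ 1 1 : ℤ))) * φ τ z
  elliptic : ∀ (a b : ℤ) (τ : ℍ) (z : ℂ),
    φ τ (z + a * τ + b) = cexp (-(2 * π * I * m * (a ^ 2 * τ + 2 * a * z))) * φ τ z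
  /-- The Fourier expansion `∑ c(n, l) q^n y^l` runs over `n ≥ 0` and `l ∈ ℤ`. -/
  fourier : ∃ c : ℕ → ℤ → ℂ, ∀ (τ : ℍ) (z : ℂ),
    HasSum (fun p : ℕ × ℤ =>
      c p.1 p.2 * cexp (2 * π * I * τ) ^ p.1 * cexp (2 * π * I * z) ^ p.2) (φ τ z)

/-- Taylor series at `x = 0` of `θ₁(τ, z + x / (2 π i))`. -/
def numSeries (τ : ℍ) (z : ℂ) : PowerSeries ℂ :=
  PowerSeries.mk fun n =>
    iteratedDeriv n (fun x : ℂ => theta1 τ (z + x / (2 * π * I))) 0 / n.factorial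

/-- Taylor series at `x = 0` of `θ₁(τ, x / (2 π i)) / x`; recall that `θ₁(τ, 0) = 0`. -/
def denSeries (τ : ℍ) : PowerSeries ℂ :=
  PowerSeries.mk fun n =>
    iteratedDeriv (n + 1) (fun x : ℂ => theta1 τ (x / (2 * π * I))) 0 / (n + 1).factorial

/-- The characteristic power series
`Q(x) = x θ₁(τ, z + x / (2 π i)) / θ₁(τ, x / (2 π i))` of the elliptic genus. -/
def charSeries (τ : ℍ) (z : ℂ) : PowerSeries ℂ := numSeries τ z * (denSeries τ)⁻¹

/-- The elliptic genus `∫_S Q(x₁) Q(x₂)` of a compact complex surface `S` with Chern roots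
`x₁, x₂` and Chern numbers `c₁²`, `c₂`. The degree two part of `Q(x₁) Q(x₂)` is
`Q₀ Q₂ (x₁² + x₂²) + Q₁² x₁ x₂`, where `x₁² + x₂² = c₁² - 2 c₂` and `x₁ x₂ = c₂`. -/
def surfaceEllipticGenus (c₁sq c₂ : ℤ) (τ : ℍ) (z : ℂ) : ℂ :=
  PowerSeries.coeff 0 (charSeries τ z) * PowerSeries.coeff 2 (charSeries τ z) *
      ((c₁sq : ℂ) - 2 * c₂) +
    PowerSeries.coeff 1 (charSeries τ z) ^ 2 * c₂

/-- The elliptic genus of a K3 surface, whose Chern numbers are `c₁² = 0` and `c₂ = 24`. -/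
def ellipticGenusK3 (τ : ℍ) (z : ℂ) : ℂ := surfaceEllipticGenus 0 24 τ z

end ALEGenus

end

/-! On the line `t₂ = -t₁` the weights at every fixed point are `-rt` and `rt`. With `f = θ₁(τ, ·)`
odd, the sum is therefore `-r` times `f(z + w) f(z - w) / f(w)²` at `w = rt`. Expanding in `w`, the
double pole has coefficient `f(z)² / f'(0)²`. Since `f'(0) = 2πη³`, this is the subtracted singular
part. The constant term gives, for all `z`, `Z^reg = -r (f f'' - f'² - κ f²) / f'(0)²`, with `κ =
f'''(0) / (3 f'(0))` (`regularizedEllipticGenus_eq`), and every claim follows from this formula.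

Weierstrass form: `(f f'' - f'²) / f² = (log f)''` is elliptic with principal part `-1/w²`, so `℘ =
κ - (log f)''` by Liouville (`weierstrassP_eq`). K3: the formula is `r (Q₁² - 2 Q₀ Q₂)` in the
coefficients of `Q` (`regularizedEllipticGenus_eq_K3`).

Jacobi laws: off the lattice they follow from those of `℘` and `(θ₁/η³)²`. The modular laws of both
are again obtained from Liouville, and continuity in `z` covers the lattice points.

Fourier expansion: up to a factor depending on `τ` only, `θ₁` is `y^{-1/2}` times a theta series
(`exists_theta1_eq`). The formula is insensitive to that factor, and the only quantity inverted is
the derivative of the series at `z = 0`, a holomorphic nowhere zero function of `q` in the unit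
disc. Joint holomorphy is then read off from the expansion. -/

noncomputable section

namespace ALEGenus

/-! ### The product for `θ₁`: zeros, oddness, quasi-periodicity, derivative at the origin. -/

/-- The infinite product `∏_{m ≥ 0} (1 - x q^m)`. -/
def qPoch (q x : ℂ) : ℂ := ∏' m : ℕ, (1 - x * q ^ m)

theorem summable_norm_mul_pow {q : ℂ} (hq : ‖q‖ < 1) (x : ℂ) :
    Summable fun m : ℕ => ‖-(x * q ^ m)‖ := by
  simpa using (summable_geometric_of_lt_one (norm_nonneg _) hq).mul_left ‖x‖

theorem multipliable_one_sub_mul_pow {q : ℂ} (hq : ‖q‖ < 1) (x : ℂ) :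
    Multipliable fun m : ℕ => 1 - x * q ^ m := by
  simpa [sub_eq_add_neg] using multipliable_one_add_of_summable (summable_norm_mul_pow hq x)

theorem qPoch_eq {q : ℂ} (hq : ‖q‖ < 1) (x : ℂ) : qPoch q x = (1 - x) * qPoch q (q * x) := by
  have h : HasProd (fun m : ℕ => 1 - x * q ^ (m + 1)) (qPoch q (q * x)) := by
    have := (multipliable_one_sub_mul_pow hq (q * x)).hasProd
    rw [qPoch]
    refine this.congr_fun fun m => ?_
    ring
  have := HasProd.zero_mul (f := fun m : ℕ => 1 - x * q ^ m) h
  rw [pow_zero, mul_one] at this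
  exact this.tprod_eq

theorem qPoch_eq_zero_iff {q : ℂ} (hq : ‖q‖ < 1) (x : ℂ) :
    qPoch q x = 0 ↔ ∃ m : ℕ, x * q ^ m = 1 := by
  constructor
  · intro h
    by_contra! hne
    refine tprod_one_add_ne_zero_of_summable (f := fun m : ℕ => -(x * q ^ m)) (fun m h0 => ?_)
      (summable_norm_mul_pow hq x) ?_
    · exact hne m (by linear_combination -h0)
    · simpa [qPoch, sub_eq_add_neg] using h
  · rintro ⟨m, hm⟩
    exact tprod_of_exists_eq_zero ⟨m, by rw [hm, sub_self]⟩

theorem differentiable_qPoch {q : ℂ} (hq : ‖q‖ < 1) : Differentiable ℂ (qPoch q) := by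
  have h : HasProdLocallyUniformlyOn (fun (m : ℕ) x => 1 + -(x * q ^ m))
      (fun x => ∏' m : ℕ, (1 + -(x * q ^ m))) Set.univ := by
    refine hasProdLocallyUniformlyOn_of_forall_compact isOpen_univ fun K _ hK => ?_
    obtain ⟨B, hB⟩ := hK.exists_bound_of_continuousOn continuousOn_id
    refine ((summable_geometric_of_lt_one (norm_nonneg _) hq).mul_left B).hasProdUniformlyOn_nat_one_add
      hK (.of_forall fun n x hx => ?_) fun n => by fun_prop
    simpa using mul_le_mul_of_nonneg_right (hB x hx) (by positivity)
  rw [← differentiableOn_univ]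
  refine (h.differentiableOn (.of_forall fun _ => ?_) isOpen_univ).congr fun x _ => ?_
  · simpa [Finset.prod_fn] using DifferentiableOn.finsetProd (fun _ _ => by fun_prop)
  · simp [qPoch, sub_eq_add_neg]

theorem theta1_eq (τ : ℍ) (z : ℂ) : theta1 τ z =
    I * cexp (2 * π * I * τ / 8) * cexp (-(π * I * z)) *
      (qPoch (cexp (2 * π * I * τ)) (cexp (2 * π * I * τ)) *
        qPoch (cexp (2 * π * I * τ)) (cexp (2 * π * I * z)) *
        qPoch (cexp (2 * π * I * τ)) (cexp (2 * π * I * τ) * (cexp (2 * π * I * z))⁻¹)) := by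
  have hq := norm_exp_two_pi_I_lt_one τ
  set q := cexp (2 * π * I * τ)
  set y := cexp (2 * π * I * z)
  have h1 := multipliable_one_sub_mul_pow hq q
  have h2 := multipliable_one_sub_mul_pow hq y
  have h3 := multipliable_one_sub_mul_pow hq (q * y⁻¹)
  rw [theta1, qPoch, qPoch, qPoch, ← h1.tprod_mul h2, ← (h1.mul h2).tprod_mul h3]
  congr 1
  refine tprod_congr fun m => ?_
  rw [pow_succ]
  ring

theorem differentiable_theta1 (τ : ℍ) : Differentiable ℂ (theta1 τ) := by
  have h : theta1 τ = fun z => _ := funext (theta1_eq τ)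
  have hq := differentiable_qPoch (norm_exp_two_pi_I_lt_one τ)
  rw [h]
  refine .mul (by fun_prop) (.mul (.const_mul (hq.comp (by fun_prop)) _) (hq.comp ?_))
  simp_rw [← Complex.exp_neg]
  fun_prop

/-- `θ₁(τ, z) = (1 - y) H(z)` with the cofactor `H` regular at `z = 0`. -/
theorem theta1_eq_one_sub_mul (τ : ℍ) (z : ℂ) : theta1 τ z = (1 - cexp (2 * π * I * z)) *
    (I * cexp (2 * π * I * τ / 8) * cexp (-(π * I * z)) *
      (qPoch (cexp (2 * π * I * τ)) (cexp (2 * π * I * τ)) *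
        qPoch (cexp (2 * π * I * τ)) (cexp (2 * π * I * τ) * cexp (2 * π * I * z)) *
        qPoch (cexp (2 * π * I * τ)) (cexp (2 * π * I * τ) * cexp (-(2 * π * I * z))))) := by
  rw [theta1_eq, qPoch_eq (norm_exp_two_pi_I_lt_one τ) (cexp (2 * π * I * z)),
    Complex.exp_neg (2 * π * I * z)]
  ring

theorem theta1_zero (τ : ℍ) : theta1 τ 0 = 0 := by simp [theta1_eq_one_sub_mul]

theorem eta_cube (τ : ℍ) : ModularForm.eta (τ : ℂ) ^ 3 =
    cexp (2 * π * I * τ / 8) * qPoch (cexp (2 * π * I * τ)) (cexp (2 * π * I * τ)) ^ 3 := by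
  rw [ModularForm.eta, mul_pow, Function.Periodic.qParam, ← Complex.exp_nat_mul]
  congr 1
  · congr 1
    push_cast
    ring
  · congr 1
    refine tprod_congr fun m => ?_
    rw [ModularForm.eta_q_eq_pow, pow_succ']

/-- This matches the double pole of the genus with the singular term. As `1 - y` vanishes at `z = 0`
with derivative `-2πi`, only the value `i η³` of the cofactor there enters. -/
theorem deriv_theta1_zero (τ : ℍ) :
    deriv (theta1 τ) 0 = 2 * π * ModularForm.eta (τ : ℂ) ^ 3 := by
  have h : theta1 τ = fun z => _ := funext (theta1_eq_one_sub_mul τ)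
  have hq := differentiable_qPoch (norm_exp_two_pi_I_lt_one τ)
  have h1 : HasDerivAt (fun z : ℂ => 1 - cexp (2 * π * I * z)) (-(2 * π * I)) 0 := by
    have := (((hasDerivAt_id (0 : ℂ)).const_mul (2 * π * I)).cexp).const_sub 1
    simpa using this
  have h2 : DifferentiableAt ℂ (fun z => (I * cexp (2 * π * I * τ / 8) * cexp (-(π * I * z)) *
      (qPoch (cexp (2 * π * I * τ)) (cexp (2 * π * I * τ)) *
        qPoch (cexp (2 * π * I * τ)) (cexp (2 * π * I * τ) * cexp (2 * π * I * z)) *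
        qPoch (cexp (2 * π * I * τ)) (cexp (2 * π * I * τ) * cexp (-(2 * π * I * z)))))) 0 := by
    refine .mul (by fun_prop) (.mul (.const_mul (hq.differentiableAt.comp _ (by fun_prop)) _)
      (hq.differentiableAt.comp _ (by fun_prop)))
  rw [h, (h1.fun_mul h2.hasDerivAt).deriv, eta_cube]
  simp
  linear_combination (-2 * π * cexp (2 * π * I * τ / 8) *
    qPoch (cexp (2 * π * I * τ)) (cexp (2 * π * I * τ)) ^ 3) * I_sq

theorem deriv_theta1_zero_ne_zero (τ : ℍ) : deriv (theta1 τ) 0 ≠ 0 := by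
  rw [deriv_theta1_zero]
  have := ModularForm.eta_ne_zero τ.2
  have := Real.pi_ne_zero
  simp_all

theorem theta1_neg (τ : ℍ) (z : ℂ) : theta1 τ (-z) = -theta1 τ z := by
  have hy : cexp (-(2 * π * I * z)) * cexp (2 * π * I * z) = 1 := by
    rw [← Complex.exp_add]; simp
  have hy2 : cexp (π * I * z) = cexp (-(π * I * z)) * cexp (2 * π * I * z) := by
    rw [← Complex.exp_add]; ring_nf
  rw [theta1_eq_one_sub_mul, theta1_eq_one_sub_mul]
  simp only [mul_neg, neg_neg]
  rw [hy2]
  linear_combination (-I * cexp (2 * π * I * τ / 8) * cexp (-(π * I * z)) *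
      (qPoch (cexp (2 * π * I * τ)) (cexp (2 * π * I * τ)) *
        qPoch (cexp (2 * π * I * τ)) (cexp (2 * π * I * τ) * cexp (2 * π * I * z)) *
        qPoch (cexp (2 * π * I * τ)) (cexp (2 * π * I * τ) * cexp (-(2 * π * I * z))))) * hy

theorem theta1_add_one (τ : ℍ) (z : ℂ) : theta1 τ (z + 1) = -theta1 τ z := by
  have h1 : cexp (2 * π * I * (z + 1)) = cexp (2 * π * I * z) := by
    rw [mul_add, mul_one, Complex.exp_add, Complex.exp_two_pi_mul_I, mul_one]
  have h2 : cexp (-(π * I * (z + 1))) = -cexp (-(π * I * z)) := by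
    rw [mul_add, mul_one, neg_add, Complex.exp_add, Complex.exp_neg (π * I), Complex.exp_pi_mul_I]
    norm_num
  rw [theta1_eq, theta1_eq, h1, h2]
  ring

/-- The shift replaces `y` by `qy`, which moves one linear factor from one product to the other. -/
theorem theta1_add_tau (τ : ℍ) (z : ℂ) :
    theta1 τ (z + τ) = cexp (π * I - π * I * τ - 2 * π * I * z) * theta1 τ z := by
  have hq := norm_exp_two_pi_I_lt_one τ
  have hy : cexp (-(2 * π * I * z)) * cexp (2 * π * I * z) = 1 := by
    rw [← Complex.exp_add]; simp
  have h0 : cexp (2 * π * I * (z + τ)) = cexp (2 * π * I * τ) * cexp (2 * π * I * z) := by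
    rw [← Complex.exp_add]; ring_nf
  have h1 : cexp (2 * π * I * τ) * (cexp (2 * π * I * (z + τ)))⁻¹ = cexp (-(2 * π * I * z)) := by
    rw [← Complex.exp_neg, ← Complex.exp_add]; ring_nf
  have h2 : cexp (-(π * I * (z + τ))) * cexp (-(2 * π * I * z)) =
      -(cexp (π * I - π * I * τ - 2 * π * I * z) * cexp (-(π * I * z))) := by
    rw [← Complex.exp_add, ← Complex.exp_add, ← neg_one_mul (cexp _), ← Complex.exp_pi_mul_I,
      ← Complex.exp_add]
    refine Complex.exp_eq_exp_iff_exists_int.2 ⟨-1, ?_⟩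
    push_cast
    ring
  rw [theta1_eq, h1, h0, theta1_eq_one_sub_mul, qPoch_eq hq (cexp (-(2 * π * I * z)))]
  set A := qPoch (cexp (2 * π * I * τ)) (cexp (2 * π * I * τ))
  set B := qPoch (cexp (2 * π * I * τ)) (cexp (2 * π * I * τ) * cexp (2 * π * I * z))
  set C := qPoch (cexp (2 * π * I * τ)) (cexp (2 * π * I * τ) * cexp (-(2 * π * I * z)))
  set k := cexp (2 * π * I * τ / 8)
  linear_combination (I * k * A * B * C * (cexp (2 * π * I * z) - 1)) * h2 -
    I * k * A * B * C * cexp (-(π * I * (z + τ))) * hy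

theorem mem_lattice_periods (τ : ℍ) (z : ℂ) :
    z ∈ (periods τ).lattice ↔ ∃ m n : ℤ, m + n * (τ : ℂ) = z := by
  simp [PeriodPair.mem_lattice, periods]

/-- The product in `y` vanishes on `ℤ - mτ` and the one in `y⁻¹` on `ℤ + (m + 1)τ`, for `m ≥ 0`;
together these exhaust the lattice. -/
theorem theta1_eq_zero_iff (τ : ℍ) (z : ℂ) :
    theta1 τ z = 0 ↔ z ∈ (periods τ).lattice := by
  have hq := norm_exp_two_pi_I_lt_one τ
  have h2pi : (2 * π * I : ℂ) ≠ 0 := Complex.two_pi_I_ne_zero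
  have hA : qPoch (cexp (2 * π * I * τ)) (cexp (2 * π * I * τ)) ≠ 0 := by
    rw [Ne, qPoch_eq_zero_iff hq]
    rintro ⟨m, hm⟩
    rw [← pow_succ'] at hm
    have := congrArg norm hm
    rw [norm_pow, norm_one, pow_eq_one_iff_of_nonneg (norm_nonneg _) (by simp)] at this
    exact hq.ne this
  have e1 : ∀ m : ℕ, cexp (2 * π * I * z) * cexp (2 * π * I * τ) ^ m =
      cexp (2 * π * I * (z + m * τ)) := fun m => by
    rw [← Complex.exp_nat_mul, ← Complex.exp_add]; ring_nf
  have e2 : ∀ m : ℕ, cexp (2 * π * I * τ) * (cexp (2 * π * I * z))⁻¹ * cexp (2 * π * I * τ) ^ m =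
      cexp (2 * π * I * (-z + (m + 1) * τ)) := fun m => by
    rw [← Complex.exp_nat_mul, ← Complex.exp_neg, ← Complex.exp_add, ← Complex.exp_add]; ring_nf
  have e3 : ∀ w : ℂ, cexp (2 * π * I * w) = 1 ↔ ∃ n : ℤ, w = n := fun w => by
    rw [Complex.exp_eq_one_iff]
    refine exists_congr fun n => ?_
    rw [mul_comm (n : ℂ), mul_right_inj' h2pi]
  rw [theta1_eq, mem_lattice_periods]
  simp only [mul_eq_zero, I_ne_zero, Complex.exp_ne_zero, hA, false_or, qPoch_eq_zero_iff hq, e1,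
    e2, e3]
  constructor
  · rintro (⟨m, n, h⟩ | ⟨m, n, h⟩)
    · exact ⟨n, -m, by push_cast; linear_combination -h⟩
    · exact ⟨-n, m + 1, by push_cast; linear_combination h⟩
  · rintro ⟨m, n, rfl⟩
    obtain ⟨k, rfl | rfl⟩ := n.eq_nat_or_neg
    · rcases k with _ | k
      · exact Or.inl ⟨0, m, by simp⟩
      · exact Or.inr ⟨k, -m, by push_cast; ring⟩
    · exact Or.inl ⟨k, m, by push_cast; ring⟩

/-! ### Liouville's theorem for elliptic functions, and density off the lattice. -/

/-- The limit at `0` makes the singularities at all lattice points removable. The extension is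
entire and doubly periodic, hence bounded, hence equal to its value at `0`. -/
theorem eq_of_doubly_periodic (L : PeriodPair) {G : ℂ → ℂ} {c : ℂ}
    (hd : ∀ z ∉ L.lattice, DifferentiableAt ℂ G z)
    (h₁ : ∀ z ∉ L.lattice, G (z + L.ω₁) = G z) (h₂ : ∀ z ∉ L.lattice, G (z + L.ω₂) = G z)
    (hlim : Tendsto G (𝓝[≠] 0) (𝓝 c)) (z : ℂ) (hz : z ∉ L.lattice) : G z = c := by
  classical
  let F : ℂ → ℂ := fun z => if z ∈ L.lattice then c else G z
  have hF₁ : Function.Periodic F L.ω₁ := fun z => by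
    by_cases h : z ∈ L.lattice
    · simp [F, h, add_mem h L.ω₁_mem_lattice]
    · have h' : z + L.ω₁ ∉ L.lattice := fun h0 => h (by
        simpa using sub_mem h0 L.ω₁_mem_lattice)
      simp [F, h, h', h₁ z h]
  have hF₂ : Function.Periodic F L.ω₂ := fun z => by
    by_cases h : z ∈ L.lattice
    · simp [F, h, add_mem h L.ω₂_mem_lattice]
    · have h' : z + L.ω₂ ∉ L.lattice := fun h0 => h (by
        simpa using sub_mem h0 L.ω₂_mem_lattice)
      simp [F, h, h', h₂ z h]
  have hF : ∀ l ∈ L.lattice, Function.Periodic F l := fun l hl => by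
    obtain ⟨m, n, rfl⟩ := PeriodPair.mem_lattice.1 hl
    exact (hF₁.int_mul m).add_period (hF₂.int_mul n)
  have hdF : ∀ z ∉ L.lattice, DifferentiableAt ℂ F z := fun z hz =>
    (hd z hz).congr_of_eventuallyEq <| by
      filter_upwards [L.isClosed_lattice.isOpen_compl.mem_nhds hz] with w hw
      exact if_neg hw
  have hF0 : F 0 = c := if_pos (zero_mem _)
  have hpunct : ∀ᶠ w in 𝓝[≠] (0 : ℂ), w ∉ L.lattice := by
    filter_upwards [self_mem_nhdsWithin,
      mem_nhdsWithin_of_mem_nhds (L.compl_lattice_sdiff_singleton_mem_nhds 0)] with w hw hw' h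
    exact hw' ⟨h, hw⟩
  have hdF0 : DifferentiableAt ℂ F 0 := by
    refine (Complex.analyticAt_of_differentiable_on_punctured_nhds_of_continuousAt
      (hpunct.mono hdF) ?_).differentiableAt
    rw [continuousAt_iff_punctured_nhds, hF0]
    exact hlim.congr' (hpunct.mono fun w hw => (if_neg hw).symm)
  have hFd : Differentiable ℂ F := fun w => by
    by_cases hw : w ∈ L.lattice
    -- Periodicity transports differentiability from `0` to the lattice point `w`.
    · have h : F = fun x => F (x - w) := funext fun x => ((hF w hw).sub_eq x).symm
      rw [h]
      refine DifferentiableAt.fun_comp' w (g := F) ?_ (by fun_prop)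
      rwa [sub_self]
    · exact hdF w hw
  have := hFd.apply_eq_apply_of_bounded (IsZLattice.isCompact_range_of_periodic L.lattice F
    hFd.continuous fun z w hw => hF w hw z).isBounded z 0
  rw [hF0] at this
  simpa [F, hz] using this

theorem eq_of_eq_off_lattice (L : PeriodPair) {f g : ℂ → ℂ} (hf : Continuous f)
    (hg : Continuous g) (h : ∀ z ∉ L.lattice, f z = g z) : f = g := by
  have : Countable L.lattice := L.latticeEquivProd.toEquiv.countable_iff.2 inferInstance
  exact hf.ext_on (Set.Countable.dense_compl ℂ (Set.to_countable (L.lattice : Set ℂ))) hg h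

/-! ### Second order expansions of an odd function with a simple zero at the origin. -/

section Taylor

variable {f : ℂ → ℂ}

theorem differentiable_dslope (hf : Differentiable ℂ f) (c : ℂ) : Differentiable ℂ (dslope f c) := by
  rw [← differentiableOn_univ] at hf ⊢
  exact (Complex.differentiableOn_dslope Filter.univ_mem).2 hf

theorem differentiable_deriv (hf : Differentiable ℂ f) : Differentiable ℂ (deriv f) := by
  rw [← differentiableOn_univ] at hf ⊢
  exact hf.deriv isOpen_univ

theorem eq_mul_dslope (h0 : f 0 = 0) (w : ℂ) : f w = w * dslope f 0 w := by
  have := sub_smul_dslope f 0 w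
  simpa [h0] using this.symm

theorem deriv_eq_dslope_add (hf : Differentiable ℂ f) (h0 : f 0 = 0) (w : ℂ) :
    deriv f w = dslope f 0 w + w * deriv (dslope f 0) w := by
  have hd := differentiable_dslope hf 0
  have h : f = fun w => w * dslope f 0 w := funext (eq_mul_dslope h0)
  conv_lhs => rw [h]
  simpa using ((hasDerivAt_id w).fun_mul (hd w).hasDerivAt).deriv

theorem deriv_deriv_eq_dslope (hf : Differentiable ℂ f) (h0 : f 0 = 0) (w : ℂ) :
    deriv (deriv f) w = 2 * deriv (dslope f 0) w + w * deriv (deriv (dslope f 0)) w := by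
  have hd := differentiable_dslope hf 0
  have hd' := differentiable_deriv hd
  rw [funext (deriv_eq_dslope_add hf h0)]
  rw [((hd w).hasDerivAt.fun_add ((hasDerivAt_id' w).fun_mul (hd' w).hasDerivAt)).deriv]
  ring

theorem deriv_deriv_deriv_zero_eq_dslope (hf : Differentiable ℂ f) (h0 : f 0 = 0) :
    deriv (deriv (deriv f)) 0 = 3 * deriv (deriv (dslope f 0)) 0 := by
  have hd' := differentiable_deriv (differentiable_dslope hf 0)
  have hd'' := differentiable_deriv hd'
  rw [funext (deriv_deriv_eq_dslope hf h0)]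
  rw [(((hd' 0).hasDerivAt.const_mul 2).fun_add
    ((hasDerivAt_id' 0).fun_mul (hd'' 0).hasDerivAt)).deriv]
  ring

theorem dslope_neg_of_odd (h0 : f 0 = 0) (hodd : ∀ z, f (-z) = -f z) (w : ℂ) :
    dslope f 0 (-w) = dslope f 0 w := by
  rcases eq_or_ne w 0 with rfl | hw
  · simp
  · have h1 := eq_mul_dslope h0 w
    have h2 := eq_mul_dslope h0 (-w)
    rw [hodd, h1] at h2
    exact mul_left_cancel₀ hw (by linear_combination h2)

theorem deriv_dslope_zero_of_odd (h0 : f 0 = 0) (hodd : ∀ z, f (-z) = -f z) :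
    deriv (dslope f 0) 0 = 0 := by
  have h := deriv_comp_neg (dslope f 0) 0
  rw [funext (dslope_neg_of_odd h0 hodd), neg_zero] at h
  linear_combination h / 2

/-- Dividing out `w` twice by `dslope` leaves an entire function whose value at `0` is `K''(0) / 2`.
-/
theorem tendsto_div_sq {K K' : ℂ → ℂ} {k : ℂ} (h : ∀ w, HasDerivAt K (K' w) w)
    (h' : HasDerivAt K' k 0) (h0 : K 0 = 0) (h0' : K' 0 = 0) :
    Tendsto (fun w => K w / w ^ 2) (𝓝[≠] 0) (𝓝 (k / 2)) := by
  have hK : Differentiable ℂ K := fun w => (h w).differentiableAt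
  have hd := differentiable_dslope hK 0
  have hK' : deriv K = K' := funext fun w => (h w).deriv
  have hd0 : dslope K 0 0 = 0 := by rw [dslope_same, hK', h0']
  have hk : dslope (dslope K 0) 0 0 = k / 2 := by
    have := deriv_deriv_eq_dslope hK h0 0
    rw [hK', h'.deriv] at this
    rw [dslope_same, this]
    ring
  rw [← hk]
  refine ((differentiable_dslope hd 0).continuous.tendsto 0).mono_left nhdsWithin_le_nhds |>.congr' ?_
  filter_upwards [self_mem_nhdsWithin] with w hw
  have hw : w ≠ 0 := hw
  rw [eq_mul_dslope h0 w, eq_mul_dslope hd0 w]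
  field_simp

/-- The constant term of `-f''/f + (f'/f)² + 1/w²` at `w = 0` for an odd function `f` with a simple
zero at the origin. -/
def oddConst (f : ℂ → ℂ) : ℂ := deriv (deriv (deriv f)) 0 / (3 * deriv f 0)

/-- The Wronskian type expression `f f'' - f'²`. -/
def hirota (f : ℂ → ℂ) (z : ℂ) : ℂ := f z * deriv (deriv f) z - deriv f z ^ 2

theorem tendsto_symm_div_sq (hf : Differentiable ℂ f) (hodd : ∀ z, f (-z) = -f z)
    (ha : deriv f 0 ≠ 0) (z : ℂ) :
    Tendsto (fun w => f (z + w) * f (z - w) / f w ^ 2 - f z ^ 2 / (deriv f 0 ^ 2 * w ^ 2)) (𝓝[≠] 0)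
      (𝓝 ((hirota f z - oddConst f * f z ^ 2) / deriv f 0 ^ 2)) := by
  have h0 : f 0 = 0 := by
    have := hodd 0
    rw [neg_zero] at this
    linear_combination this / 2
  set d := dslope f 0 with hd_def
  have hd : Differentiable ℂ d := differentiable_dslope hf 0
  have hd' := differentiable_deriv hd
  have hf' := differentiable_deriv hf
  have hd0 : d 0 = deriv f 0 := dslope_same f 0
  have hd'0 : deriv d 0 = 0 := deriv_dslope_zero_of_odd h0 hodd
  have hd''0 := deriv_deriv_deriv_zero_eq_dslope hf h0
  have p : ∀ {g : ℂ → ℂ}, Differentiable ℂ g → ∀ w, HasDerivAt (fun w => g (z + w)) (deriv g (z + w)) w :=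
    fun hg w => by simpa using (hg (z + w)).hasDerivAt.comp_const_add z w
  have m : ∀ {g : ℂ → ℂ}, Differentiable ℂ g →
      ∀ w, HasDerivAt (fun w => g (z - w)) (-deriv g (z - w)) w :=
    fun hg w => (hg (z - w)).hasDerivAt.comp_const_sub z w
  -- Write `f w = w * d w`. Over the common denominator `f'(0)² w² d(w)²` the difference has this
  -- `K` as numerator; `K` vanishes to second order because `d 0 = f'(0)` and `d' 0 = 0`.
  have hK := tendsto_div_sq
    (K := fun w => deriv f 0 ^ 2 * (f (z + w) * f (z - w)) - f z ^ 2 * (d w * d w))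
    (fun w => (((p hf w).fun_mul (m hf w)).const_mul _).fun_sub
      (((hd w).hasDerivAt.fun_mul (hd w).hasDerivAt).const_mul _))
    ((((((p hf' 0).fun_mul (m hf 0))).fun_add ((p hf 0).fun_mul (m hf' 0).fun_neg)).const_mul _).fun_sub
      ((((hd' 0).hasDerivAt.fun_mul (hd 0).hasDerivAt).fun_add
        ((hd 0).hasDerivAt.fun_mul (hd' 0).hasDerivAt)).const_mul _))
    (by simp [hd0]; ring) (by simp [hd'0, mul_comm])
  have hq : Tendsto (fun w => deriv f 0 ^ 2 * d w ^ 2) (𝓝[≠] 0) (𝓝 (deriv f 0 ^ 2 * d 0 ^ 2)) :=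
    ((hd.continuous.pow 2).const_mul _).tendsto 0 |>.mono_left nhdsWithin_le_nhds
  have hne : deriv f 0 ^ 2 * d 0 ^ 2 ≠ 0 := by rw [hd0]; positivity
  have hlim := hK.div hq hne
  have hdne : ∀ᶠ w in 𝓝[≠] (0 : ℂ), d w ≠ 0 :=
    (hd.continuous.continuousAt.eventually_ne (by rwa [hd0])).filter_mono nhdsWithin_le_nhds
  convert hlim.congr' ?_ using 2
  · simp only [add_zero, sub_zero, hd0, hd'0, hirota, oddConst, hd''0]
    field_simp
    ring
  · filter_upwards [self_mem_nhdsWithin, hdne] with w hw hdw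
    have hw : w ≠ 0 := hw
    rw [Pi.div_apply, eq_mul_dslope h0 w, ← hd_def]
    field_simp

/-- With `f w = w * d w`, `hirota f / f²` is `(log f)'' = -1/w² + (log d)''`, and `(log d)''` is
regular at `0`. -/
theorem tendsto_hirota_div_sq (hf : Differentiable ℂ f) (hodd : ∀ z, f (-z) = -f z)
    (ha : deriv f 0 ≠ 0) :
    Tendsto (fun w => hirota f w / f w ^ 2 + 1 / w ^ 2) (𝓝[≠] 0) (𝓝 (oddConst f)) := by
  have h0 : f 0 = 0 := by
    have := hodd 0
    rw [neg_zero] at this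
    linear_combination this / 2
  set d := dslope f 0 with hd_def
  have hd : Differentiable ℂ d := differentiable_dslope hf 0
  have hd' := differentiable_deriv hd
  have hd'' := differentiable_deriv hd'
  have hd0 : d 0 = deriv f 0 := dslope_same f 0
  have hd'0 : deriv d 0 = 0 := deriv_dslope_zero_of_odd h0 hodd
  have hd''0 := deriv_deriv_deriv_zero_eq_dslope hf h0
  have hlim : Tendsto (fun w => (d w * deriv (deriv d) w - deriv d w ^ 2) / d w ^ 2) (𝓝 0)
      (𝓝 ((d 0 * deriv (deriv d) 0 - deriv d 0 ^ 2) / d 0 ^ 2)) := by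
    have : ContinuousAt (fun w => (d w * deriv (deriv d) w - deriv d w ^ 2) / d w ^ 2) 0 :=
      (((hd.continuous.mul hd''.continuous).sub (hd'.continuous.pow 2)).continuousAt).div
        (hd.continuous.pow 2).continuousAt (by rw [hd0]; positivity)
    exact this
  have hdne : ∀ᶠ w in 𝓝[≠] (0 : ℂ), d w ≠ 0 :=
    (hd.continuous.continuousAt.eventually_ne (by rwa [hd0])).filter_mono nhdsWithin_le_nhds
  convert (hlim.mono_left nhdsWithin_le_nhds).congr' ?_ using 2
  · simp only [hd0, hd'0, oddConst, hd''0]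
    field_simp
    ring
  · filter_upwards [self_mem_nhdsWithin, hdne] with w hw hdw
    have hw : w ≠ 0 := hw
    rw [hirota, deriv_deriv_eq_dslope hf h0 w, deriv_eq_dslope_add hf h0 w, eq_mul_dslope h0 w,
      ← hd_def]
    field_simp
    ring

/-- The logarithm of the multiplier is affine in `z`, so it drops out of `(log f)''`. -/
theorem hirota_of_quasiperiodic (hf : Differentiable ℂ f) {ω α β : ℂ}
    (h : ∀ z, f (z + ω) = cexp (α + β * z) * f z) (z : ℂ) :
    hirota f (z + ω) = cexp (α + β * z) ^ 2 * hirota f z := by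
  have hf' := differentiable_deriv hf
  have hE : ∀ w, HasDerivAt (fun w => cexp (α + β * w)) (cexp (α + β * w) * β) w := fun w => by
    simpa using (((hasDerivAt_id w).const_mul β).const_add α).cexp
  have h1 : ∀ w, deriv f (w + ω) =
      cexp (α + β * w) * β * f w + cexp (α + β * w) * deriv f w := fun w => by
    rw [← deriv_comp_add_const, funext h]
    exact ((hE w).fun_mul (hf w).hasDerivAt).deriv
  have h2 : deriv (deriv f) (z + ω) =
      cexp (α + β * z) * β * β * f z + cexp (α + β * z) * β * deriv f z +
        (cexp (α + β * z) * β * deriv f z + cexp (α + β * z) * deriv (deriv f) z) := by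
    rw [← deriv_comp_add_const, funext h1]
    exact ((((hE z).mul_const β).fun_mul (hf z).hasDerivAt).fun_add
      ((hE z).fun_mul (hf' z).hasDerivAt)).deriv
  rw [hirota, h, h1, h2, hirota]
  ring

end Taylor

/-! ### The limit on the antidiagonal torus. -/

theorem equivariantEllipticGenus_sub_singularTerm (r : ℕ) (hr : 1 ≤ r) (τ : ℍ) (z t : ℂ) :
    equivariantEllipticGenus r τ z t (-t) - singularTerm r τ z t =
      -r * (theta1 τ (z + r * t) * theta1 τ (z - r * t) / theta1 τ (r * t) ^ 2 -
        theta1 τ z ^ 2 / (deriv (theta1 τ) 0 ^ 2 * (r * t) ^ 2)) := by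
  have hr : (r : ℂ) ≠ 0 := by exact_mod_cast (by lia : r ≠ 0)
  have hX : ∀ j : ℕ, weightX r j t (-t) = -(r * t) := fun j => by rw [weightX]; ring
  have hY : ∀ j : ℕ, weightY r j t (-t) = r * t := fun j => by rw [weightY]; ring
  simp only [equivariantEllipticGenus, hX, hY, Finset.sum_const, Finset.card_range, nsmul_eq_mul,
    theta1_neg, ← sub_eq_add_neg, singularTerm, deriv_theta1_zero]
  rw [div_pow, div_mul_div_comm, mul_sub]
  congr 1
  · rw [neg_mul, div_neg, ← sq, mul_comm (theta1 τ (z - _))]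
    ring
  · field_simp

theorem tendsto_equivariantEllipticGenus (r : ℕ) (hr : 1 ≤ r) (τ : ℍ) (z : ℂ) :
    Tendsto (fun t : ℂ => equivariantEllipticGenus r τ z t (-t) - singularTerm r τ z t)
      (𝓝[≠] (0 : ℂ)) (𝓝 (-r * ((hirota (theta1 τ) z - oddConst (theta1 τ) * theta1 τ z ^ 2) /
        deriv (theta1 τ) 0 ^ 2))) := by
  have hr0 : (r : ℂ) ≠ 0 := by exact_mod_cast (by lia : r ≠ 0)
  simp only [equivariantEllipticGenus_sub_singularTerm r hr]
  refine ((tendsto_symm_div_sq (differentiable_theta1 τ) (theta1_neg τ)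
    (deriv_theta1_zero_ne_zero τ) z).const_mul _).comp (f := fun t : ℂ => r * t) ?_
  refine tendsto_nhdsWithin_iff.2 ⟨?_, ?_⟩
  · have : ContinuousAt (fun t : ℂ => r * t) 0 := by fun_prop
    simpa [ContinuousAt] using this.tendsto.mono_left nhdsWithin_le_nhds
  · filter_upwards [self_mem_nhdsWithin] with t ht
    exact mul_ne_zero hr0 ht

theorem regularizedEllipticGenus_eq (r : ℕ) (hr : 1 ≤ r) (τ : ℍ) (z : ℂ) :
    regularizedEllipticGenus r τ z =
      -r * ((hirota (theta1 τ) z - oddConst (theta1 τ) * theta1 τ z ^ 2) /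
        deriv (theta1 τ) 0 ^ 2) :=
  (tendsto_equivariantEllipticGenus r hr τ z).limUnder_eq

theorem continuous_regularizedEllipticGenus (r : ℕ) (hr : 1 ≤ r) (τ : ℍ) :
    Continuous (regularizedEllipticGenus r τ) := by
  have h := differentiable_theta1 τ
  have h1 := differentiable_deriv h
  have h2 := (differentiable_deriv h1).continuous
  have h := h.continuous
  have h1 := h1.continuous
  simp only [funext (regularizedEllipticGenus_eq r hr τ), hirota]
  fun_prop

/-! ### The Weierstrass form and the elliptic transformation law. -/

section Weierstrass

theorem tendsto_weierstrassP_sub (L : PeriodPair) :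
    Tendsto (fun w => L.weierstrassP w - 1 / w ^ 2) (𝓝[≠] 0) (𝓝 0) := by
  have h := (L.analyticAt_weierstrassPExcept 0).continuousAt.tendsto
  rw [L.weierstrassPExcept_zero] at h
  refine (h.mono_left nhdsWithin_le_nhds).congr fun w => ?_
  rw [← L.weierstrassPExcept_add 0 w]
  simp

theorem quasiperiodic_one (τ : ℍ) (z : ℂ) :
    theta1 τ (z + (periods τ).ω₁) = cexp (π * I + 0 * z) * theta1 τ z := by
  simp [periods, theta1_add_one]

theorem quasiperiodic_tau (τ : ℍ) (z : ℂ) :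
    theta1 τ (z + (periods τ).ω₂) =
      cexp ((π * I - π * I * τ) + -(2 * π * I) * z) * theta1 τ z := by
  rw [neg_mul, ← sub_eq_add_neg]
  exact theta1_add_tau τ z

/-- The sum of `℘` and `(log θ₁)''` is elliptic and its poles cancel. Its constant value is read off
at `0`, where `℘ - 1/w²` tends to `0`. -/
theorem weierstrassP_eq (τ : ℍ) (z : ℂ) (hz : z ∉ (periods τ).lattice) :
    (periods τ).weierstrassP z =
      oddConst (theta1 τ) - hirota (theta1 τ) z / theta1 τ z ^ 2 := by
  have hf := differentiable_theta1 τ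
  have hf1 := differentiable_deriv hf
  have hf2 := differentiable_deriv hf1
  have key := eq_of_doubly_periodic (periods τ)
    (G := fun z => (periods τ).weierstrassP z + hirota (theta1 τ) z / theta1 τ z ^ 2)
    (c := oddConst (theta1 τ)) (fun z hz => ?_) (fun z hz => ?_) (fun z hz => ?_) ?_ z hz
  · rw [← key]; ring
  · have h0 : theta1 τ z ≠ 0 := fun h => hz ((theta1_eq_zero_iff τ z).1 h)
    refine .add ((periods τ).differentiableOn_weierstrassP.differentiableAt
      ((periods τ).isClosed_lattice.isOpen_compl.mem_nhds hz)) ?_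
    refine .div (((hf z).mul (hf2 z)).sub ((hf1 z).pow 2)) ((hf z).pow 2) (by positivity)
  · rw [hirota_of_quasiperiodic hf (quasiperiodic_one τ), quasiperiodic_one, mul_pow,
      mul_div_mul_left _ _ (pow_ne_zero 2 (Complex.exp_ne_zero _)),
      (periods τ).weierstrassP_add_coe z ⟨_, (periods τ).ω₁_mem_lattice⟩]
  · rw [hirota_of_quasiperiodic hf (quasiperiodic_tau τ), quasiperiodic_tau, mul_pow,
      mul_div_mul_left _ _ (pow_ne_zero 2 (Complex.exp_ne_zero _)),
      (periods τ).weierstrassP_add_coe z ⟨_, (periods τ).ω₂_mem_lattice⟩]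
  · have := (tendsto_weierstrassP_sub (periods τ)).add
      (tendsto_hirota_div_sq hf (theta1_neg τ) (deriv_theta1_zero_ne_zero τ))
    rw [zero_add] at this
    exact this.congr fun w => by ring

/-- The square of `θ₁ / η³`, which is up to a constant the weak Jacobi form of weight `-2` and
index `1`. -/
def thetaSq (τ : ℍ) (z : ℂ) : ℂ := (theta1 τ z / ModularForm.eta (τ : ℂ) ^ 3) ^ 2

theorem regularizedEllipticGenus_eq_weierstrassP (r : ℕ) (hr : 1 ≤ r) (τ : ℍ) (z : ℂ)
    (hz : z ∉ (periods τ).lattice) :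
    regularizedEllipticGenus r τ z =
      (r : ℂ) / (2 * (π : ℂ)) ^ 2 * thetaSq τ z * (periods τ).weierstrassP z := by
  have h0 : theta1 τ z ≠ 0 := fun h => hz ((theta1_eq_zero_iff τ z).1 h)
  have hη := ModularForm.eta_ne_zero τ.2
  have hπ : (π : ℂ) ≠ 0 := by exact_mod_cast Real.pi_ne_zero
  rw [regularizedEllipticGenus_eq r hr, weierstrassP_eq τ z hz, deriv_theta1_zero, thetaSq]
  field_simp
  ring

theorem thetaSq_ne_zero {τ : ℍ} {z : ℂ} (hz : z ∉ (periods τ).lattice) : thetaSq τ z ≠ 0 :=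
  pow_ne_zero 2 (div_ne_zero (fun h => hz ((theta1_eq_zero_iff τ z).1 h))
    (pow_ne_zero 3 (ModularForm.eta_ne_zero τ.2)))

theorem differentiable_thetaSq (τ : ℍ) : Differentiable ℂ (thetaSq τ) :=
  ((differentiable_theta1 τ).div_const _).pow 2

theorem thetaSq_add_one (τ : ℍ) (z : ℂ) : thetaSq τ (z + 1) = thetaSq τ z := by
  rw [thetaSq, theta1_add_one, thetaSq]
  ring

theorem thetaSq_add_tau (τ : ℍ) (z : ℂ) :
    thetaSq τ (z + τ) = cexp (-(2 * π * I * (τ + 2 * z))) * thetaSq τ z := by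
  have h : cexp (-(2 * π * I * (τ + 2 * z))) = cexp (π * I - π * I * τ - 2 * π * I * z) ^ 2 := by
    rw [← Complex.exp_nat_mul, Complex.exp_eq_exp_iff_exists_int]
    exact ⟨-1, by push_cast; ring⟩
  rw [thetaSq, theta1_add_tau, thetaSq, h]
  ring

theorem thetaSq_add_int (τ : ℍ) (n : ℤ) (z : ℂ) : thetaSq τ (z + n) = thetaSq τ z := by
  simpa using Function.Periodic.int_mul (f := thetaSq τ) (thetaSq_add_one τ) n z

theorem thetaSq_add_int_mul_tau (τ : ℍ) (m : ℤ) (z : ℂ) :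
    thetaSq τ (z + m * τ) = cexp (-(2 * π * I * (m ^ 2 * τ + 2 * m * z))) * thetaSq τ z := by
  induction m using Int.induction_on generalizing z with
  | zero => simp
  | succ m ih =>
    have h : z + ((m + 1 : ℤ) : ℂ) * τ = (z + τ) + (m : ℤ) * τ := by push_cast; ring
    rw [h, ih, thetaSq_add_tau, ← mul_assoc, ← Complex.exp_add]
    congr 2
    push_cast
    ring
  | pred m ih =>
    have h : z + ((-m - 1 : ℤ) : ℂ) * τ = (z - τ) + (-m : ℤ) * τ := by push_cast; ring
    have h2 := thetaSq_add_tau τ (z - τ)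
    rw [sub_add_cancel] at h2
    rw [h, ih, h2, ← mul_assoc, ← Complex.exp_add]
    congr 2
    push_cast
    ring

theorem thetaSq_add (τ : ℍ) (m n : ℤ) (z : ℂ) :
    thetaSq τ (z + m * τ + n) =
      cexp (-(2 * π * I * (m ^ 2 * τ + 2 * m * z))) * thetaSq τ z := by
  rw [thetaSq_add_int, thetaSq_add_int_mul_tau]

/-- The limit does not depend on `τ`. This fixes the constant in `thetaSq_modular` without the
modular laws of `θ₁` and `η`. -/
theorem tendsto_thetaSq_div_sq (τ : ℍ) :
    Tendsto (fun w => thetaSq τ w / w ^ 2) (𝓝[≠] 0) (𝓝 ((2 * π) ^ 2)) := by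
  have hη := ModularForm.eta_ne_zero τ.2
  have hd := differentiable_dslope (differentiable_theta1 τ) 0
  have h : ContinuousAt (fun w => (dslope (theta1 τ) 0 w / ModularForm.eta (τ : ℂ) ^ 3) ^ 2) 0 :=
    (hd.continuous.div_const _).pow 2 |>.continuousAt
  have := h.tendsto
  rw [dslope_same, deriv_theta1_zero, mul_div_assoc, div_self (pow_ne_zero 3 hη), mul_one] at this
  refine (this.mono_left nhdsWithin_le_nhds).congr' ?_
  filter_upwards [self_mem_nhdsWithin] with w hw
  have hw : w ≠ 0 := hw
  rw [thetaSq, eq_mul_dslope (theta1_zero τ) w]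
  field_simp

theorem regularizedEllipticGenus_elliptic (r : ℕ) (hr : 1 ≤ r) (a b : ℤ) (τ : ℍ) (z : ℂ) :
    regularizedEllipticGenus r τ (z + a * τ + b) =
      cexp (-(2 * π * I * (a ^ 2 * τ + 2 * a * z))) * regularizedEllipticGenus r τ z := by
  have hc := continuous_regularizedEllipticGenus r hr τ
  refine congrFun (eq_of_eq_off_lattice (periods τ)
    (f := fun z => regularizedEllipticGenus r τ (z + a * τ + b))
    (g := fun z => cexp (-(2 * π * I * (a ^ 2 * τ + 2 * a * z))) * regularizedEllipticGenus r τ z)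
    (by fun_prop) (by fun_prop) fun z hz => ?_) z
  have hl : a * (τ : ℂ) + b ∈ (periods τ).lattice :=
    (mem_lattice_periods τ _).2 ⟨b, a, by ring⟩
  have hz' : z + a * τ + b ∉ (periods τ).lattice := fun h => hz (by
    have := sub_mem h hl
    rwa [add_assoc, add_sub_cancel_right] at this)
  rw [regularizedEllipticGenus_eq_weierstrassP r hr τ z hz,
    regularizedEllipticGenus_eq_weierstrassP r hr τ _ hz', thetaSq_add, add_assoc z,
    (periods τ).weierstrassP_add_coe z ⟨_, hl⟩]
  ring

end Weierstrass

/-! ### Modular transformation laws. -/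

section Modular

variable (γ : SL(2, ℤ)) (τ : ℍ)

/-- The automorphy factor `c τ + d`. -/
def autFactor : ℂ := (γ 1 0 : ℤ) * (τ : ℂ) + (γ 1 1 : ℤ)

theorem autFactor_ne_zero : autFactor γ τ ≠ 0 := by
  simpa [autFactor, UpperHalfPlane.denom] using UpperHalfPlane.denom_ne_zero γ τ

theorem coe_smul_mul_autFactor :
    ((γ • τ : ℍ) : ℂ) * autFactor γ τ = (γ 0 0 : ℤ) * (τ : ℂ) + (γ 0 1 : ℤ) := by
  rw [← eq_div_iff (autFactor_ne_zero γ τ), UpperHalfPlane.coe_specialLinearGroup_apply]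
  simp [autFactor]

theorem det_eq_one :
    ((γ 0 0 : ℤ) : ℂ) * (γ 1 1 : ℤ) - (γ 0 1 : ℤ) * (γ 1 0 : ℤ) = 1 := by
  have := γ.det_coe
  rw [Matrix.det_fin_two] at this
  exact_mod_cast this

/-- Together with `tau_div_autFactor` this shows that division by `cτ + d` carries the periods of
`τ` into the lattice of `γ • τ`. -/
theorem one_div_autFactor :
    1 / autFactor γ τ = (γ 0 0 : ℤ) - (γ 1 0 : ℤ) * ((γ • τ : ℍ) : ℂ) := by
  rw [div_eq_iff (autFactor_ne_zero γ τ), sub_mul, mul_assoc, coe_smul_mul_autFactor, autFactor]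
  linear_combination -det_eq_one γ

theorem tau_div_autFactor :
    (τ : ℂ) / autFactor γ τ = (γ 1 1 : ℤ) * ((γ • τ : ℍ) : ℂ) - (γ 0 1 : ℤ) := by
  rw [div_eq_iff (autFactor_ne_zero γ τ), sub_mul, mul_assoc, coe_smul_mul_autFactor, autFactor]
  linear_combination -(τ : ℂ) * det_eq_one γ

variable {τ} in
theorem div_autFactor_notMem {z : ℂ} (hz : z ∉ (periods τ).lattice) :
    z / autFactor γ τ ∉ (periods (γ • τ)).lattice := by
  rw [mem_lattice_periods] at hz ⊢
  rintro ⟨m, n, h⟩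
  refine hz ⟨m * γ 1 1 + n * γ 0 1, m * γ 1 0 + n * γ 0 0, ?_⟩
  rw [eq_div_iff (autFactor_ne_zero γ τ), add_mul, mul_assoc, coe_smul_mul_autFactor,
    autFactor] at h
  push_cast
  linear_combination h

theorem tendsto_div_autFactor :
    Tendsto (fun z : ℂ => z / autFactor γ τ) (𝓝[≠] 0) (𝓝[≠] 0) := by
  refine tendsto_nhdsWithin_iff.2 ⟨?_, ?_⟩
  · have : ContinuousAt (fun z : ℂ => z / autFactor γ τ) 0 := by fun_prop
    simpa [ContinuousAt] using this.tendsto.mono_left nhdsWithin_le_nhds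
  · filter_upwards [self_mem_nhdsWithin] with t ht
    exact div_ne_zero ht (autFactor_ne_zero γ τ)

/-- The difference of the two sides is elliptic for the lattice of `τ`; the poles `(cτ + d)²/w²`
cancel and it tends to `0` at the origin. -/
theorem weierstrassP_modular (z : ℂ) (hz : z ∉ (periods τ).lattice) :
    (periods (γ • τ)).weierstrassP (z / autFactor γ τ) =
      autFactor γ τ ^ 2 * (periods τ).weierstrassP z := by
  have hJ := autFactor_ne_zero γ τ
  have key := eq_of_doubly_periodic (periods τ)
    (G := fun z => (periods (γ • τ)).weierstrassP (z / autFactor γ τ) -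
      autFactor γ τ ^ 2 * (periods τ).weierstrassP z)
    (c := 0) (fun z hz => ?_) (fun z hz => ?_) (fun z hz => ?_) ?_ z hz
  · linear_combination key
  · refine .sub (DifferentiableAt.fun_comp' z (g := (periods (γ • τ)).weierstrassP) ?_
      (by fun_prop)) (.const_mul ?_ _)
    · exact (periods _).differentiableOn_weierstrassP.differentiableAt
        ((periods _).isClosed_lattice.isOpen_compl.mem_nhds (div_autFactor_notMem γ hz))
    · exact (periods τ).differentiableOn_weierstrassP.differentiableAt
        ((periods τ).isClosed_lattice.isOpen_compl.mem_nhds hz)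
  · have hl : 1 / autFactor γ τ ∈ (periods (γ • τ)).lattice := by
      rw [one_div_autFactor, mem_lattice_periods]
      exact ⟨γ 0 0, -γ 1 0, by push_cast; ring⟩
    rw [(periods τ).weierstrassP_add_coe z ⟨_, (periods τ).ω₁_mem_lattice⟩, add_div,
      show (periods τ).ω₁ = 1 from rfl, (periods _).weierstrassP_add_coe _ ⟨_, hl⟩]
  · have hl : τ / autFactor γ τ ∈ (periods (γ • τ)).lattice := by
      rw [tau_div_autFactor, mem_lattice_periods]
      exact ⟨-γ 0 1, γ 1 1, by push_cast; ring⟩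
    rw [(periods τ).weierstrassP_add_coe z ⟨_, (periods τ).ω₂_mem_lattice⟩, add_div,
      show (periods τ).ω₂ = τ from rfl, (periods _).weierstrassP_add_coe _ ⟨_, hl⟩]
  · have := ((tendsto_weierstrassP_sub (periods (γ • τ))).comp (tendsto_div_autFactor γ τ)).sub
      ((tendsto_weierstrassP_sub (periods τ)).const_mul (autFactor γ τ ^ 2))
    rw [mul_zero, sub_zero] at this
    refine this.congr' ?_
    filter_upwards [self_mem_nhdsWithin] with w hw
    have hw : w ≠ 0 := hw
    simp only [Function.comp]
    field_simp
    ring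

/-- The quotient of the two sides has no poles, because `thetaSq τ` vanishes only on the lattice,
and the exponential corrects the multipliers to make it elliptic. It tends to `1` at the origin. -/
theorem thetaSq_modular (z : ℂ) (hz : z ∉ (periods τ).lattice) :
    autFactor γ τ ^ 2 * thetaSq (γ • τ) (z / autFactor γ τ) =
      cexp (2 * π * I * (γ 1 0 : ℤ) * z ^ 2 / autFactor γ τ) * thetaSq τ z := by
  have hJ := autFactor_ne_zero γ τ
  have key := eq_of_doubly_periodic (periods τ)
    (G := fun z => autFactor γ τ ^ 2 * cexp (-(2 * π * I * (γ 1 0 : ℤ) * z ^ 2 / autFactor γ τ)) *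
      thetaSq (γ • τ) (z / autFactor γ τ) / thetaSq τ z)
    (c := 1) (fun z hz => ?_) (fun z hz => ?_) (fun z hz => ?_) ?_ z hz
  · rw [div_eq_one_iff_eq (thetaSq_ne_zero hz), Complex.exp_neg] at key
    rw [← key]
    field_simp
  · refine .div (.mul (by fun_prop) ((differentiable_thetaSq _).differentiableAt.comp z
      (by fun_prop))) (differentiable_thetaSq τ z) (thetaSq_ne_zero hz)
  · have h1 : (z + (periods τ).ω₁) / autFactor γ τ =
        z / autFactor γ τ + (-γ 1 0 : ℤ) * ((γ • τ : ℍ) : ℂ) + (γ 0 0 : ℤ) := by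
      rw [add_div, show (periods τ).ω₁ = 1 from rfl, one_div_autFactor]
      push_cast
      ring
    rw [h1, thetaSq_add, show (periods τ).ω₁ = 1 from rfl, thetaSq_add_one]
    congr 1
    rw [← mul_assoc, mul_assoc (autFactor γ τ ^ 2), ← Complex.exp_add]
    congr 2
    rw [Complex.exp_eq_exp_iff_exists_int]
    -- The exponents differ by `-2πi c (1/(cτ + d) + c γτ) = -2πi ca`.
    refine ⟨-γ 1 0 * γ 0 0, ?_⟩
    have := one_div_autFactor γ τ
    push_cast
    linear_combination (-2 * π * I * (γ 1 0 : ℤ)) * this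
  · have h1 : (z + (periods τ).ω₂) / autFactor γ τ =
        z / autFactor γ τ + (γ 1 1 : ℤ) * ((γ • τ : ℍ) : ℂ) + (-γ 0 1 : ℤ) := by
      rw [add_div, show (periods τ).ω₂ = τ from rfl, tau_div_autFactor]
      push_cast
      ring
    rw [h1, thetaSq_add, show (periods τ).ω₂ = τ from rfl, thetaSq_add_tau]
    rw [div_eq_div_iff (mul_ne_zero (Complex.exp_ne_zero _) (thetaSq_ne_zero hz))
      (thetaSq_ne_zero hz)]
    have hexp : cexp (-(2 * π * I * (γ 1 0 : ℤ) * (z + τ) ^ 2 / autFactor γ τ)) *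
        cexp (-(2 * π * I * ((γ 1 1 : ℤ) ^ 2 * ((γ • τ : ℍ) : ℂ) +
          2 * (γ 1 1 : ℤ) * (z / autFactor γ τ)))) =
        cexp (-(2 * π * I * (γ 1 0 : ℤ) * z ^ 2 / autFactor γ τ)) *
          cexp (-(2 * π * I * (τ + 2 * z))) := by
      rw [← Complex.exp_add, ← Complex.exp_add, Complex.exp_eq_exp_iff_exists_int]
      -- Here the exponents differ by `-2πi bd`, using `ad - bc = 1`.
      refine ⟨-γ 1 1 * γ 0 1, ?_⟩
      have h := tau_div_autFactor γ τ
      have h2 := coe_smul_mul_autFactor γ τ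
      have h3 := det_eq_one γ
      have h4 : (z : ℂ) / autFactor γ τ * autFactor γ τ = z := div_mul_cancel₀ _ hJ
      push_cast
      simp only [div_eq_mul_inv] at h h4 ⊢
      have hJ2 : autFactor γ τ = (γ 1 0 : ℤ) * (τ : ℂ) + (γ 1 1 : ℤ) := rfl
      generalize autFactor γ τ = J at *
      linear_combination (2 * π * I) * (-2 * h4 - (γ 1 0 : ℤ) * (τ : ℂ) * h - (γ 1 1 : ℤ) * h2 -
        (τ : ℂ) * h3 + (2 * z * J⁻¹ + (γ 1 1 : ℤ) * ((γ • τ : ℍ) : ℂ)) * hJ2)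
    linear_combination (autFactor γ τ ^ 2 * thetaSq (γ • τ) (z / autFactor γ τ) *
      thetaSq τ z) * hexp
  · have := ((tendsto_thetaSq_div_sq (γ • τ)).comp (tendsto_div_autFactor γ τ)).div
      (tendsto_thetaSq_div_sq τ) (by
        have := Real.pi_ne_zero
        simp_all)
    rw [div_self (by have := Real.pi_ne_zero; simp_all)] at this
    have he : Tendsto (fun z => cexp (-(2 * π * I * (γ 1 0 : ℤ) * z ^ 2 / autFactor γ τ))) (𝓝[≠] 0)
        (𝓝 1) := by
      have : ContinuousAt
          (fun z => cexp (-(2 * π * I * (γ 1 0 : ℤ) * z ^ 2 / autFactor γ τ))) 0 := by fun_prop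
      simpa [ContinuousAt] using this.tendsto.mono_left nhdsWithin_le_nhds
    have := he.mul this
    rw [mul_one] at this
    refine this.congr' ?_
    filter_upwards [self_mem_nhdsWithin] with w hw
    have hw : w ≠ 0 := hw
    simp only [Function.comp, Pi.div_apply]
    field_simp

theorem regularizedEllipticGenus_modular (r : ℕ) (hr : 1 ≤ r) (z : ℂ) :
    regularizedEllipticGenus r (γ • τ) (z / autFactor γ τ) =
      cexp (2 * π * I * (γ 1 0 : ℤ) * z ^ 2 / autFactor γ τ) * regularizedEllipticGenus r τ z := by
  have hc := continuous_regularizedEllipticGenus r hr τ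
  have hc' := continuous_regularizedEllipticGenus r hr (γ • τ)
  refine congrFun (eq_of_eq_off_lattice (periods τ)
    (f := fun z => regularizedEllipticGenus r (γ • τ) (z / autFactor γ τ))
    (g := fun z => cexp (2 * π * I * (γ 1 0 : ℤ) * z ^ 2 / autFactor γ τ) *
      regularizedEllipticGenus r τ z)
    (by fun_prop) (by fun_prop) fun z hz => ?_) z
  rw [regularizedEllipticGenus_eq_weierstrassP r hr τ z hz,
    regularizedEllipticGenus_eq_weierstrassP r hr _ _ (div_autFactor_notMem γ hz),
    weierstrassP_modular γ τ z hz]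
  linear_combination (r : ℂ) / (2 * (π : ℂ)) ^ 2 * (periods τ).weierstrassP z *
    thetaSq_modular γ τ z hz

end Modular

/-! ### Comparison with the K3 surface. -/

section CharSeries

theorem iteratedDeriv_comp_add_div {f : ℂ → ℂ} (hf : Differentiable ℂ f) (z c : ℂ) (n : ℕ) :
    iteratedDeriv n (fun x => f (z + x / c)) 0 = c⁻¹ ^ n * iteratedDeriv n f z := by
  have hg : ContDiff ℂ n (fun x => f (z + x)) := hf.contDiff.comp (by fun_prop)
  have h := congrFun (iteratedDeriv_comp_const_mul hg c⁻¹) 0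
  simp only [mul_zero, iteratedDeriv_comp_const_add, add_zero] at h
  rw [← h]
  simp only [div_eq_inv_mul]

/-- For `c₁² = 0`, `c₂ = 24` the genus is `24 (Q₁² - 2 Q₀ Q₂)`. The `Qᵢ` are found by solving `Q *
denSeries = numSeries` up to degree two; the linear coefficient of `denSeries` is zero as `θ₁''(0) =
0`, and the powers of `1/(2πi)` cancel. -/
theorem regularizedEllipticGenus_eq_K3 (r : ℕ) (hr : 1 ≤ r) (τ : ℍ) (z : ℂ) :
    regularizedEllipticGenus r τ z = (r : ℂ) / 24 * ellipticGenusK3 τ z := by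
  have hf := differentiable_theta1 τ
  have ha := deriv_theta1_zero_ne_zero τ
  set c : ℂ := (2 * π * I)⁻¹ with hc
  have hc0 : c ≠ 0 := inv_ne_zero Complex.two_pi_I_ne_zero
  have hN : ∀ n, PowerSeries.coeff n (numSeries τ z) =
      c ^ n * iteratedDeriv n (theta1 τ) z / n.factorial := fun n => by
    rw [numSeries, PowerSeries.coeff_mk, iteratedDeriv_comp_add_div hf]
  have hD : ∀ n, PowerSeries.coeff n (denSeries τ) =
      c ^ (n + 1) * iteratedDeriv (n + 1) (theta1 τ) 0 / (n + 1).factorial := fun n => by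
    rw [denSeries, PowerSeries.coeff_mk, ← iteratedDeriv_comp_add_div hf]
    simp
  have h2 : deriv (deriv (theta1 τ)) 0 = 0 := by
    have := deriv_deriv_eq_dslope hf (theta1_zero τ) 0
    rwa [deriv_dslope_zero_of_odd (theta1_zero τ) (theta1_neg τ), mul_zero, zero_mul,
      add_zero] at this
  have hN0 := hN 0
  have hN1 := hN 1
  have hN2 := hN 2
  have hD0 := hD 0
  have hD1 := hD 1
  have hD2 := hD 2
  simp only [iteratedDeriv_succ, iteratedDeriv_zero, Nat.factorial, h2] at hN0 hN1 hN2 hD0 hD1 hD2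
  have hmul : charSeries τ z * denSeries τ = numSeries τ z := by
    rw [charSeries, mul_assoc, PowerSeries.inv_mul_cancel, mul_one]
    rw [← PowerSeries.coeff_zero_eq_constantCoeff_apply, hD0]
    simp [hc0, ha]
  have e0 := congrArg (PowerSeries.coeff 0) hmul
  have e1 := congrArg (PowerSeries.coeff 1) hmul
  have e2 := congrArg (PowerSeries.coeff 2) hmul
  simp only [PowerSeries.coeff_mul, Finset.Nat.antidiagonal_succ, Finset.Nat.antidiagonal_zero,
    Finset.sum_cons, Finset.map_singleton, Finset.sum_singleton,
    Finset.map_cons, Function.Embedding.prodMap, Function.Embedding.coeFn_mk, Prod.map,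
    Function.Embedding.refl_apply, Nat.succ_eq_add_one, zero_add] at e0 e1 e2
  rw [regularizedEllipticGenus_eq r hr, ellipticGenusK3, surfaceEllipticGenus, hirota, oddConst]
  norm_num only [hN0, hN1, hN2, hD0, hD1, hD2] at e0 e1 e2
  generalize PowerSeries.coeff 0 (charSeries τ z) = Q₀ at *
  generalize PowerSeries.coeff 1 (charSeries τ z) = Q₁ at *
  generalize PowerSeries.coeff 2 (charSeries τ z) = Q₂ at *
  generalize deriv (deriv (deriv (theta1 τ))) 0 = f₃ at *
  generalize deriv (deriv (theta1 τ)) z = g₂ at *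
  generalize deriv (theta1 τ) z = g₁ at *
  generalize deriv (theta1 τ) 0 = a at *
  generalize theta1 τ z = g at *
  have hQ₀ : Q₀ = g / (c * a) := by
    rw [eq_div_iff (mul_ne_zero hc0 ha)]
    linear_combination e0
  have hQ₁ : Q₁ = g₁ / a := by
    rw [eq_div_iff ha]
    exact mul_left_cancel₀ hc0 (by linear_combination e1)
  have hQ₂ : Q₂ = (c ^ 2 * g₂ / 2 - Q₀ * (c ^ 3 * f₃ / 6)) / (c * a) := by
    rw [eq_div_iff (mul_ne_zero hc0 ha)]
    linear_combination e2
  rw [hQ₂, hQ₁, hQ₀]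
  push_cast
  field_simp
  ring

end CharSeries

/-! ### Algebra of Fourier expansions. -/

/-- `φ` has the absolutely convergent expansion `∑ c(n, l) q^n y^l`. -/
def HasFourier (c : ℕ × ℤ → ℂ) (φ : ℍ → ℂ → ℂ) : Prop :=
  ∀ (τ : ℍ) (z : ℂ), HasSum (fun p : ℕ × ℤ =>
    c p * cexp (2 * π * I * τ) ^ p.1 * cexp (2 * π * I * z) ^ p.2) (φ τ z)

/-- `φ` has some expansion `∑ c(n, l) q^n y^l` over `n ≥ 0` and `l ∈ ℤ`. -/
def IsFourier (φ : ℍ → ℂ → ℂ) : Prop := ∃ c, HasFourier c φ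

section Algebra

variable {φ ψ : ℍ → ℂ → ℂ}

theorem IsFourier.add (hφ : IsFourier φ) (hψ : IsFourier ψ) :
    IsFourier fun τ z => φ τ z + ψ τ z := by
  obtain ⟨c, hc⟩ := hφ
  obtain ⟨d, hd⟩ := hψ
  exact ⟨fun p => c p + d p, fun τ z => ((hc τ z).add (hd τ z)).congr_fun fun p => by ring⟩

theorem IsFourier.const_mul (hφ : IsFourier φ) (a : ℂ) : IsFourier fun τ z => a * φ τ z := by
  obtain ⟨c, hc⟩ := hφ
  exact ⟨fun p => a * c p, fun τ z => ((hc τ z).mul_left a).congr_fun fun p => by ring⟩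

theorem IsFourier.sub (hφ : IsFourier φ) (hψ : IsFourier ψ) :
    IsFourier fun τ z => φ τ z - ψ τ z := by
  simpa only [neg_one_mul, ← sub_eq_add_neg] using hφ.add (hψ.const_mul (-1))

theorem hasSum_tsum_fiber {α β : Type*} (e : α → β) {F : α → ℂ} {S : ℂ} (h : HasSum F S) :
    HasSum (fun n => ∑' x : {x // e x = n}, F x) S := by
  have h' : HasSum (fun x : Σ n, {x // e x = n} => F x.2) S :=
    (Equiv.sigmaFiberEquiv e).hasSum_iff.2 h
  exact h'.sigma fun n => (h'.summable.sigma_factor n).hasSum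

theorem hasSum_mul_prod {α : Type*} {f g : α → ℂ} {a b : ℂ} (hf : HasSum f a) (hg : HasSum g b) :
    HasSum (fun x : α × α => f x.1 * g x.2) (a * b) :=
  hf.mul hg (summable_mul_of_summable_norm hf.summable.norm hg.summable.norm)

/-- The Cauchy product has infinite fibres, since `l` ranges over `ℤ`. Absolute convergence permits
grouping by total exponent, and the monomial is constant on each fibre. -/
theorem IsFourier.mul (hφ : IsFourier φ) (hψ : IsFourier ψ) :
    IsFourier fun τ z => φ τ z * ψ τ z := by
  obtain ⟨c, hc⟩ := hφ
  obtain ⟨d, hd⟩ := hψ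
  refine ⟨fun n => ∑' x : {x : (ℕ × ℤ) × (ℕ × ℤ) // x.1 + x.2 = n}, c x.1.1 * d x.1.2,
    fun τ z => ?_⟩
  set q := cexp (2 * π * I * τ)
  set y := cexp (2 * π * I * z) with hy_def
  have hy : y ≠ 0 := Complex.exp_ne_zero _
  refine (hasSum_tsum_fiber (fun x : (ℕ × ℤ) × (ℕ × ℤ) => x.1 + x.2)
    (hasSum_mul_prod (hc τ z) (hd τ z))).congr_fun fun n => ?_
  rw [mul_assoc, ← tsum_mul_right]
  refine tsum_congr fun x => ?_
  have h1 : n.1 = x.1.1.1 + x.1.2.1 := by rw [← Prod.fst_add, x.2]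
  have h2 : n.2 = x.1.1.2 + x.1.2.2 := by rw [← Prod.snd_add, x.2]
  rw [h1, h2, pow_add, zpow_add₀ hy]
  ring

theorem isFourier_exp_zpow (k : ℤ) : IsFourier fun _ z => cexp (2 * π * I * z) ^ k := by
  refine ⟨Pi.single (0, k) 1, fun τ z => ?_⟩
  have h := hasSum_single (f := fun p : ℕ × ℤ => (Pi.single (0, k) 1 : ℕ × ℤ → ℂ) p *
    cexp (2 * π * I * τ) ^ p.1 * cexp (2 * π * I * z) ^ p.2) (0, k) fun p hp => by simp [hp]
  simpa using h

theorem isFourier_of_differentiableOn {G : ℂ → ℂ} (hG : DifferentiableOn ℂ G (Metric.ball 0 1)) :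
    IsFourier fun τ _ => G (cexp (2 * π * I * τ)) := by
  refine ⟨fun p => if p.2 = 0 then (p.1.factorial : ℂ)⁻¹ * iteratedDeriv p.1 G 0 else 0,
    fun τ z => ?_⟩
  have h := Complex.hasSum_taylorSeries_on_ball hG (z := cexp (2 * π * I * τ))
    (by simpa using norm_exp_two_pi_I_lt_one τ)
  have hinj : Function.Injective fun n : ℕ => ((n, 0) : ℕ × ℤ) := fun a b h => by simpa using h
  rw [← hinj.hasSum_iff]
  · refine h.congr_fun fun n => ?_
    simp
    ring
  · rintro ⟨n, l⟩ hl
    have : l ≠ 0 := by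
      rintro rfl
      exact hl ⟨n, rfl⟩
    simp [this]

end Algebra

/-! ### Termwise differentiation of Fourier expansions. -/

section Analysis

variable {c : ℕ × ℤ → ℂ} {φ : ℍ → ℂ → ℂ}

theorem norm_exp_pow_mul_exp_zpow (x : ℂ × ℂ) (p : ℕ × ℤ) :
    ‖cexp (2 * π * I * x.1) ^ p.1 * cexp (2 * π * I * x.2) ^ p.2‖ =
      Real.exp (-(2 * π * x.1.im * p.1)) * Real.exp (-(2 * π * x.2.im * p.2)) := by
  rw [norm_mul, norm_pow, norm_zpow, Complex.norm_exp, Complex.norm_exp, ← Real.exp_nat_mul,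
    ← Real.rpow_intCast, ← Real.exp_mul]
  congr 2
  · simp
    ring
  · simp

/-- Absolute convergence at the points `(iδ, iR)` and `(iδ, -iR)` controls both signs of `l`. -/
theorem HasFourier.summable_bound (h : HasFourier c φ) {δ : ℝ} (hδ : 0 < δ) (R : ℝ) :
    Summable fun p : ℕ × ℤ =>
      ‖c p‖ * (Real.exp (-(2 * π * δ * p.1)) * Real.exp (2 * π * R * |(p.2 : ℝ)|)) := by
  have h1 := (h ⟨δ * I, by simpa using hδ⟩ (-R * I)).summable.norm
  have h2 := (h ⟨δ * I, by simpa using hδ⟩ (R * I)).summable.norm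
  refine (h1.add h2).of_nonneg_of_le (fun p => by positivity) fun p => ?_
  simp only [mul_assoc (c p), norm_mul (c p)]
  rw [← mul_add]
  refine mul_le_mul_of_nonneg_left ?_ (norm_nonneg _)
  have e1 := norm_exp_pow_mul_exp_zpow (δ * I, -R * I) p
  have e2 := norm_exp_pow_mul_exp_zpow (δ * I, R * I) p
  simp only [Complex.mul_im, Complex.neg_re, Complex.neg_im, ofReal_re, ofReal_im,
    Complex.I_im, Complex.I_re, mul_one, mul_zero, add_zero, neg_zero] at e1 e2
  rw [e1, e2, ← mul_add]
  refine mul_le_mul_of_nonneg_left ?_ (Real.exp_nonneg _)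
  rcases abs_cases (p.2 : ℝ) with ⟨h, -⟩ | ⟨h, -⟩ <;> rw [h]
  · refine le_add_of_le_of_nonneg (le_of_eq ?_) (Real.exp_nonneg _)
    congr 1; ring
  · refine le_add_of_nonneg_of_le (Real.exp_nonneg _) (le_of_eq ?_)
    congr 1; ring

theorem norm_le_bound {δ R : ℝ} {x : ℂ × ℂ} (h1 : δ ≤ x.1.im) (h2 : |x.2.im| ≤ R) (p : ℕ × ℤ) :
    ‖cexp (2 * π * I * x.1) ^ p.1 * cexp (2 * π * I * x.2) ^ p.2‖ ≤
      Real.exp (-(2 * π * δ * p.1)) * Real.exp (2 * π * R * |(p.2 : ℝ)|) := by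
  rw [norm_exp_pow_mul_exp_zpow]
  have hπ := Real.pi_pos
  refine mul_le_mul (Real.exp_le_exp.2 ?_) (Real.exp_le_exp.2 ?_) (Real.exp_nonneg _)
    (Real.exp_nonneg _)
  · have : (0 : ℝ) ≤ p.1 := by positivity
    gcongr
  · calc -(2 * π * x.2.im * p.2) ≤ |2 * π * x.2.im * p.2| := neg_le_abs _
      _ = 2 * π * |x.2.im| * |(p.2 : ℝ)| := by
        rw [abs_mul, abs_mul, abs_of_pos (by positivity : 0 < 2 * π)]
      _ ≤ _ := by gcongr

theorem hasDerivAt_exp_pow (τ : ℂ) (n : ℕ) :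
    HasDerivAt (fun τ : ℂ => cexp (2 * π * I * τ) ^ n)
      (2 * π * I * n * cexp (2 * π * I * τ) ^ n) τ := by
  simp only [← Complex.exp_nat_mul]
  refine (((hasDerivAt_id' τ).const_mul (2 * π * I)).const_mul (n : ℂ)).cexp.congr_deriv ?_
  ring

theorem hasDerivAt_exp_zpow (z : ℂ) (l : ℤ) :
    HasDerivAt (fun z : ℂ => cexp (2 * π * I * z) ^ l)
      (2 * π * I * l * cexp (2 * π * I * z) ^ l) z := by
  simp only [← Complex.exp_int_mul]
  refine (((hasDerivAt_id' z).const_mul (2 * π * I)).const_mul (l : ℂ)).cexp.congr_deriv ?_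
  ring

/-- The domain `δ < Im τ`, `|Im z| < R`. -/
def stripProd (δ R : ℝ) : Set (ℂ × ℂ) := {x | δ < x.1.im ∧ |x.2.im| < R}

theorem isOpen_stripProd (δ R : ℝ) : IsOpen (stripProd δ R) :=
  IsOpen.inter (s := {x : ℂ × ℂ | δ < x.1.im}) (t := {x | |x.2.im| < R})
    (isOpen_lt (by fun_prop) (by fun_prop)) (isOpen_lt (by fun_prop) (by fun_prop))

theorem isPreconnected_stripProd (δ R : ℝ) : IsPreconnected (stripProd δ R) := by
  have h : stripProd δ R = {x : ℂ | δ < x.im} ×ˢ {z : ℂ | z.im ∈ Set.Ioo (-R) R} := by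
    ext x
    simp [stripProd, abs_lt]
  rw [h]
  refine (convex_halfSpace_im_gt δ).isPreconnected.prod (Convex.isPreconnected ?_)
  exact (convex_Ioo (-R) R).is_linear_preimage Complex.imLm.isLinear

theorem two_pi_mul_nat_le_exp {δ : ℝ} (hδ : 0 < δ) (n : ℕ) :
    2 * π * n ≤ δ⁻¹ * Real.exp (2 * π * δ * n) := by
  rw [inv_mul_eq_div, le_div_iff₀ hδ]
  refine le_trans (le_of_eq ?_) (Real.add_one_le_exp _ |>.trans' (le_add_of_nonneg_right zero_le_one))
  ring

theorem HasFourier.differentiableAt (h : HasFourier c φ) {x : ℂ × ℂ} (hx : 0 < x.1.im) :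
    DifferentiableAt ℂ (fun p : ℂ × ℂ => φ (UpperHalfPlane.ofComplex p.1) p.2) x := by
  obtain ⟨δ, hδ, hδx⟩ := exists_between hx
  set R := |x.2.im| + 1
  have hxs : x ∈ stripProd δ R := ⟨hδx, lt_add_one _⟩
  have hsum : ∀ w ∈ stripProd δ R, HasSum (fun p : ℕ × ℤ =>
      c p * cexp (2 * π * I * w.1) ^ p.1 * cexp (2 * π * I * w.2) ^ p.2)
        (φ (UpperHalfPlane.ofComplex w.1) w.2) := fun w hw => by
    rw [UpperHalfPlane.ofComplex_apply_of_im_pos (hδ.trans hw.1)]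
    exact h ⟨w.1, hδ.trans hw.1⟩ w.2
  -- Differentiation produces factors `n` and `l`; they are absorbed by passing from `δ` to `δ / 2`
  -- and from `R` to `R + 1`.
  have hb := (h.summable_bound (half_pos hδ) (R + 1)).mul_left ((δ / 2)⁻¹ + 1)
  have hfd : ∀ (p : ℕ × ℤ) (w : ℂ × ℂ), HasFDerivAt
      (fun w : ℂ × ℂ => c p * cexp (2 * π * I * w.1) ^ p.1 * cexp (2 * π * I * w.2) ^ p.2)
      ((c p * (cexp (2 * π * I * w.1) ^ p.1 * cexp (2 * π * I * w.2) ^ p.2)) •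
        ((2 * π * I * p.1) • ContinuousLinearMap.fst ℂ ℂ ℂ +
          (2 * π * I * p.2) • ContinuousLinearMap.snd ℂ ℂ ℂ)) w := fun p w => by
    have h1 := (hasDerivAt_exp_pow w.1 p.1).comp_hasFDerivAt w (hasFDerivAt_fst (𝕜 := ℂ) (E := ℂ) (F := ℂ) (p := w))
    have h2 := (hasDerivAt_exp_zpow w.2 p.2).comp_hasFDerivAt w (hasFDerivAt_snd (𝕜 := ℂ) (E := ℂ) (F := ℂ) (p := w))
    refine ((h1.const_mul (c p)).mul h2).congr_fderiv ?_
    ext <;> simp <;> ring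
  have key := hasFDerivAt_tsum_of_isPreconnected hb (isOpen_stripProd δ R)
    (isPreconnected_stripProd δ R) (fun p w _ => hfd p w) (fun p w hw => ?_) hxs
    (hsum x hxs).summable hxs
  · refine key.differentiableAt.congr_of_eventuallyEq ?_
    filter_upwards [(isOpen_stripProd δ R).mem_nhds hxs] with w hw
    exact (hsum w hw).tsum_eq.symm
  · have hn := two_pi_mul_nat_le_exp (half_pos hδ) p.1
    have hl : 2 * π * |(p.2 : ℝ)| ≤ Real.exp (2 * π * |(p.2 : ℝ)|) :=
      Real.add_one_le_exp _ |>.trans' (le_add_of_nonneg_right zero_le_one)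
    have hA : ‖(2 * π * I * p.1) • ContinuousLinearMap.fst ℂ ℂ ℂ +
        (2 * π * I * p.2) • ContinuousLinearMap.snd ℂ ℂ ℂ‖ ≤
        2 * π * p.1 + 2 * π * |(p.2 : ℝ)| := by
      refine (norm_add_le _ _).trans (add_le_add ?_ ?_)
      · rw [norm_smul]
        refine (mul_le_of_le_one_right (norm_nonneg _)
          (ContinuousLinearMap.norm_fst_le ℂ ℂ ℂ)).trans (le_of_eq ?_)
        simp [abs_of_pos Real.pi_pos]
      · rw [norm_smul]
        refine (mul_le_of_le_one_right (norm_nonneg _)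
          (ContinuousLinearMap.norm_snd_le ℂ ℂ ℂ)).trans (le_of_eq ?_)
        simp [abs_of_pos Real.pi_pos]
    have h1 : (1 : ℝ) ≤ Real.exp (2 * π * (δ / 2) * p.1) := Real.one_le_exp (by positivity)
    have h2 : (1 : ℝ) ≤ Real.exp (2 * π * |(p.2 : ℝ)|) := Real.one_le_exp (by positivity)
    have hB : 2 * π * p.1 + 2 * π * |(p.2 : ℝ)| ≤ ((δ / 2)⁻¹ + 1) *
        (Real.exp (2 * π * (δ / 2) * p.1) * Real.exp (2 * π * |(p.2 : ℝ)|)) := by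
      rw [add_mul, ← mul_assoc]
      refine add_le_add (hn.trans (le_mul_of_one_le_right (by positivity) h2)) ?_
      rw [one_mul]
      exact hl.trans (le_mul_of_one_le_left (by positivity) h1)
    rw [norm_smul, norm_mul]
    calc _ ≤ ‖c p‖ * (Real.exp (-(2 * π * δ * p.1)) * Real.exp (2 * π * R * |(p.2 : ℝ)|)) *
          (((δ / 2)⁻¹ + 1) *
            (Real.exp (2 * π * (δ / 2) * p.1) * Real.exp (2 * π * |(p.2 : ℝ)|))) := by
          gcongr
          · exact norm_le_bound hw.1.le hw.2.le p
          · exact hA.trans hB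
      _ = ((δ / 2)⁻¹ + 1) * (‖c p‖ *
          ((Real.exp (-(2 * π * δ * p.1)) * Real.exp (2 * π * (δ / 2) * p.1)) *
          (Real.exp (2 * π * R * |(p.2 : ℝ)|) * Real.exp (2 * π * |(p.2 : ℝ)|)))) := by ring
      _ = _ := by
          rw [← Real.exp_add, ← Real.exp_add]
          congr 4 <;> ring_nf

theorem HasFourier.summable_deriv (h : HasFourier c φ) (τ : ℍ) (R : ℝ) :
    Summable fun p : ℕ × ℤ => ‖2 * π * I * p.2 * c p‖ *
      (Real.exp (-(2 * π * τ.im * p.1)) * Real.exp (2 * π * R * |(p.2 : ℝ)|)) := by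
  refine (h.summable_bound τ.im_pos (R + 1)).of_nonneg_of_le (fun p => by positivity) fun p => ?_
  have hl : 2 * π * |(p.2 : ℝ)| ≤ Real.exp (2 * π * |(p.2 : ℝ)|) :=
    Real.add_one_le_exp _ |>.trans' (le_add_of_nonneg_right zero_le_one)
  calc _ = 2 * π * |(p.2 : ℝ)| * (‖c p‖ *
        (Real.exp (-(2 * π * τ.im * p.1)) * Real.exp (2 * π * R * |(p.2 : ℝ)|))) := by
        simp [abs_of_pos Real.pi_pos]
        ring
    _ ≤ Real.exp (2 * π * |(p.2 : ℝ)|) * (‖c p‖ *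
        (Real.exp (-(2 * π * τ.im * p.1)) * Real.exp (2 * π * R * |(p.2 : ℝ)|))) := by gcongr
    _ = ‖c p‖ * (Real.exp (-(2 * π * τ.im * p.1)) *
        (Real.exp (2 * π * |(p.2 : ℝ)|) * Real.exp (2 * π * R * |(p.2 : ℝ)|))) := by ring
    _ = _ := by
        rw [← Real.exp_add]
        ring_nf

theorem HasFourier.hasDerivAt (h : HasFourier c φ) (τ : ℍ) (z : ℂ) :
    HasDerivAt (φ τ) (∑' p : ℕ × ℤ, 2 * π * I * p.2 * c p *
      cexp (2 * π * I * τ) ^ p.1 * cexp (2 * π * I * z) ^ p.2) z := by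
  set R := |z.im| + 1
  have hopen : IsOpen {w : ℂ | |w.im| < R} := isOpen_lt (by fun_prop) (by fun_prop)
  have hconn : IsPreconnected {w : ℂ | |w.im| < R} := by
    simp_rw [abs_lt]
    exact ((convex_Ioo (-R) R).is_linear_preimage Complex.imLm.isLinear).isPreconnected
  have hz : z ∈ {w : ℂ | |w.im| < R} := lt_add_one |z.im|
  have key := hasDerivAt_tsum_of_isPreconnected (h.summable_deriv τ R) hopen hconn
    (g := fun p z => c p * cexp (2 * π * I * τ) ^ p.1 * cexp (2 * π * I * z) ^ p.2)
    (g' := fun p z => 2 * π * I * p.2 * c p *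
      cexp (2 * π * I * τ) ^ p.1 * cexp (2 * π * I * z) ^ p.2)
    (fun p w _ => ?_) (fun p w hw => ?_) hz (h τ z).summable hz
  · rwa [funext fun w => (h τ w).tsum_eq] at key
  · refine ((hasDerivAt_exp_zpow w p.2).const_mul
      (c p * cexp (2 * π * I * τ) ^ p.1)).congr_deriv ?_
    ring
  · rw [mul_assoc, norm_mul]
    exact mul_le_mul_of_nonneg_left (norm_le_bound (x := (τ, w)) le_rfl (le_of_lt hw) p)
      (norm_nonneg _)

theorem HasFourier.deriv (h : HasFourier c φ) :
    HasFourier (fun p => 2 * π * I * p.2 * c p) fun τ => deriv (φ τ) := fun τ z => by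
  simp only [(h.hasDerivAt τ z).deriv]
  refine Summable.hasSum (.of_norm_bounded (h.summable_deriv τ |z.im|) fun p => ?_)
  rw [mul_assoc, norm_mul]
  exact mul_le_mul_of_nonneg_left (norm_le_bound (x := (τ, z)) le_rfl le_rfl p) (norm_nonneg _)

end Analysis

/-! ### Restriction to `z = 0` as a holomorphic function of `q`. -/

section Restriction

variable {c : ℕ × ℤ → ℂ} {φ : ℍ → ℂ → ℂ}

/-- The power series in `q` giving the value at `z = 0` of the expansion `∑ c(n, l) q^n y^l`. -/
def zeroSeries (c : ℕ × ℤ → ℂ) (q : ℂ) : ℂ := ∑' p : ℕ × ℤ, c p * q ^ p.1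

theorem HasFourier.apply_zero (h : HasFourier c φ) (τ : ℍ) :
    φ τ 0 = zeroSeries c (cexp (2 * π * I * τ)) := by
  simpa [zeroSeries] using (h τ 0).tsum_eq.symm

theorem HasFourier.differentiableOn_zeroSeries (h : HasFourier c φ) :
    DifferentiableOn ℂ (zeroSeries c) (Metric.ball 0 1) := by
  intro q hq
  rw [mem_ball_zero_iff] at hq
  obtain ⟨ρ, hρ, hρ1⟩ := exists_between hq
  have hρ0 : 0 < ρ := (norm_nonneg q).trans_lt hρ
  have hπ := Real.pi_pos
  -- This `δ` satisfies `exp (-2πδ) = ρ`.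
  have hb := h.summable_bound (δ := -Real.log ρ / (2 * π))
    (div_pos (neg_pos.2 (Real.log_neg hρ0 hρ1)) (by positivity)) 0
  have key : DifferentiableOn ℂ (zeroSeries c) (Metric.ball 0 ρ) := by
    refine Complex.differentiableOn_tsum_of_summable_norm hb (fun p => by fun_prop)
      Metric.isOpen_ball fun p w hw => ?_
    rw [mem_ball_zero_iff] at hw
    have he : Real.exp (-(2 * π * (-Real.log ρ / (2 * π)) * p.1)) = ρ ^ p.1 := by
      rw [← Real.rpow_natCast, Real.rpow_def_of_pos hρ0]
      congr 1
      field_simp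
    rw [he, mul_zero, zero_mul, Real.exp_zero, mul_one, norm_mul, norm_pow]
    gcongr
  exact ((key q (mem_ball_zero_iff.2 hρ)).differentiableAt
    (Metric.isOpen_ball.mem_nhds (mem_ball_zero_iff.2 hρ))).differentiableWithinAt

theorem exists_exp_eq {q : ℂ} (h0 : q ≠ 0) (h1 : ‖q‖ < 1) :
    ∃ τ : ℍ, cexp (2 * π * I * τ) = q := by
  have hπ := Real.pi_pos
  have him : (Complex.log q / (2 * π * I)).im = -Real.log ‖q‖ / (2 * π) := by
    have : Complex.log q / (2 * π * I) = (-(1 / (2 * π)) : ℝ) * (Complex.log q * I) := by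
      push_cast
      field_simp
      rw [I_sq]
      ring
    rw [this, Complex.im_ofReal_mul, Complex.mul_I_im, Complex.log_re]
    ring
  refine ⟨⟨Complex.log q / (2 * π * I), ?_⟩, ?_⟩
  · rw [him]
    exact div_pos (neg_pos.2 (Real.log_neg (norm_pos_iff.2 h0) h1)) (by positivity)
  · rw [UpperHalfPlane.coe_mk, mul_div_cancel₀ _ Complex.two_pi_I_ne_zero, Complex.exp_log h0]

end Restriction

/-! ### The theta series and the Fourier expansion of the regularized genus. -/

section ThetaSeries

/-- The theta series `∑ (-1)^l q^{l (l - 1) / 2} y^l`. -/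
def thetaSeries (τ : ℍ) (z : ℂ) : ℂ := jacobiTheta₂ (z - τ / 2 + 1 / 2) τ

/-- The Fourier coefficients of `thetaSeries`. -/
def thetaCoeff (p : ℕ × ℤ) : ℂ := if (p.1 : ℤ) * 2 = p.2 * (p.2 - 1) then (-1) ^ p.2 else 0

theorem jacobiTheta₂_term_eq (τ : ℍ) (z : ℂ) {n : ℕ} {l : ℤ} (h : (n : ℤ) * 2 = l * (l - 1)) :
    jacobiTheta₂_term l (z - τ / 2 + 1 / 2) τ =
      (-1) ^ l * cexp (2 * π * I * τ) ^ n * cexp (2 * π * I * z) ^ l := by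
  have h' : (n : ℂ) * 2 = l * (l - 1) := by exact_mod_cast congrArg (Int.cast : ℤ → ℂ) h
  rw [jacobiTheta₂_term, ← Complex.exp_pi_mul_I, ← Complex.exp_int_mul, ← Complex.exp_int_mul,
    ← Complex.exp_nat_mul, ← Complex.exp_add, ← Complex.exp_add]
  congr 1
  linear_combination (-π * I * τ) * h'

theorem hasFourier_thetaSeries : HasFourier thetaCoeff thetaSeries := fun τ z => by
  have hex : ∀ l : ℤ, ∃ n : ℕ, (n : ℤ) * 2 = l * (l - 1) := fun l => by
    obtain ⟨k, hk⟩ := (Int.even_mul_pred_self l)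
    have hk0 : 0 ≤ k := by nlinarith [sq_nonneg (2 * l - 1)]
    exact ⟨k.toNat, by rw [Int.toNat_of_nonneg hk0]; lia⟩
  choose N hN using hex
  have hinj : Function.Injective fun l : ℤ => (N l, l) := fun a b h => (Prod.ext_iff.1 h).2
  rw [← hinj.hasSum_iff]
  · refine (hasSum_jacobiTheta₂_term _ τ.im_pos).congr_fun fun l => ?_
    simp only [Function.comp, thetaCoeff, if_pos (hN l)]
    exact (jacobiTheta₂_term_eq τ z (hN l)).symm
  · rintro ⟨n, l⟩ hl
    have : ¬ (n : ℤ) * 2 = l * (l - 1) := fun h => hl ⟨l, by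
      have := hN l
      simp only [Prod.mk.injEq, and_true]
      lia⟩
    simp [thetaCoeff, this]

theorem differentiable_thetaSeries (τ : ℍ) : Differentiable ℂ (thetaSeries τ) := fun z =>
  (hasFourier_thetaSeries.hasDerivAt τ z).differentiableAt

theorem thetaSeries_add_one (τ : ℍ) (z : ℂ) : thetaSeries τ (z + 1) = thetaSeries τ z := by
  rw [thetaSeries, thetaSeries, ← jacobiTheta₂_add_left (z - τ / 2 + 1 / 2)]
  congr 1
  ring

theorem thetaSeries_add_tau (τ : ℍ) (z : ℂ) :
    thetaSeries τ (z + τ) = cexp (-(π * I * (2 * z + 1))) * thetaSeries τ z := by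
  have h : z + τ - τ / 2 + 1 / 2 = (z - τ / 2 + 1 / 2) + τ := by ring
  rw [thetaSeries, h, jacobiTheta₂_add_left', thetaSeries]
  congr 2
  ring

/-- Evenness and periodicity of `jacobiTheta₂` equate the values at `0` and `τ`, while
quasi-periodicity makes them opposite. -/
theorem thetaSeries_zero (τ : ℍ) : thetaSeries τ 0 = 0 := by
  have h1 : thetaSeries τ 0 = thetaSeries τ τ := by
    rw [thetaSeries, ← jacobiTheta₂_neg_left, ← jacobiTheta₂_add_left, thetaSeries]
    congr 1
    ring
  have h2 := thetaSeries_add_tau τ 0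
  rw [zero_add, ← h1, mul_zero, zero_add, mul_one, Complex.exp_neg, Complex.exp_pi_mul_I] at h2
  norm_num at h2
  linear_combination h2 / 2

/-- Integrating over the real period `[0, 1]` leaves only the term `l = 0`, which equals `1`. -/
theorem exists_thetaSeries_ne_zero (τ : ℍ) : ∃ z, thetaSeries τ z ≠ 0 := by
  by_contra! h
  have hs := fun x : ℝ => hasSum_jacobiTheta₂_term (x - τ / 2 + 1 / 2) τ.im_pos
  have hx : ∀ (l : ℤ) (x : ℝ), jacobiTheta₂_term l (x - τ / 2 + 1 / 2) τ =
      jacobiTheta₂_term l (-τ / 2 + 1 / 2) τ * cexp (2 * π * I * l * x) := fun l x => by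
    rw [jacobiTheta₂_term, jacobiTheta₂_term, ← Complex.exp_add]
    ring_nf
  have hnorm : ∀ (l : ℤ) (x : ℝ), ‖cexp (2 * π * I * l * x)‖ = 1 := fun l x => by
    simp [Complex.norm_exp]
  have hint := intervalIntegral.hasSum_integral_of_dominated_convergence (a := 0) (b := 1)
    (μ := MeasureTheory.volume)
    (F := fun (l : ℤ) (x : ℝ) => jacobiTheta₂_term l (x - τ / 2 + 1 / 2) τ) (f := fun _ => 0)
    (fun l _ => ‖jacobiTheta₂_term l (-τ / 2 + 1 / 2) τ‖)
    (fun l => Continuous.aestronglyMeasurable (by simp only [jacobiTheta₂_term]; fun_prop))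
    (fun l => .of_forall fun x _ => by rw [hx, norm_mul, hnorm, mul_one])
    (.of_forall fun x _ => (hasSum_jacobiTheta₂_term _ τ.im_pos).summable.norm) (by simp)
    (.of_forall fun x _ => by
      have := hs x
      rwa [show jacobiTheta₂ (x - τ / 2 + 1 / 2) τ = 0 from h x] at this)
  have hterm : ∀ l : ℤ, l ≠ 0 →
      ∫ x in (0 : ℝ)..1, jacobiTheta₂_term l (x - τ / 2 + 1 / 2) τ = 0 := fun l hl => by
    have hc : (2 * π * I * l : ℂ) ≠ 0 := mul_ne_zero Complex.two_pi_I_ne_zero (by exact_mod_cast hl)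
    simp_rw [hx]
    rw [intervalIntegral.integral_const_mul, integral_exp_mul_complex hc]
    have : cexp (2 * π * I * l) = 1 := Complex.exp_eq_one_iff.2 ⟨l, by ring⟩
    simp [this]
  have h0 := hint.unique (hasSum_single 0 hterm)
  simp [jacobiTheta₂_term] at h0

/-- The Jacobi triple product up to a factor `C` depending on `τ`. Both sides have the same
multipliers and vanish at `0`, so their quotient is constant by Liouville. -/
theorem exists_theta1_eq (τ : ℍ) :
    ∃ C : ℂ, C ≠ 0 ∧ ∀ z, theta1 τ z = C * cexp (-(π * I * z)) * thetaSeries τ z := by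
  set s : ℂ → ℂ := fun z => cexp (-(π * I * z)) * thetaSeries τ z with hs_def
  have hs : Differentiable ℂ s := .mul (by fun_prop) (differentiable_thetaSeries τ)
  have hθ := differentiable_theta1 τ
  have ha := deriv_theta1_zero_ne_zero τ
  have hs0 : s 0 = 0 := by simp [hs_def, thetaSeries_zero]
  have hne : ∀ z ∉ (periods τ).lattice, theta1 τ z ≠ 0 :=
    fun z hz h => hz ((theta1_eq_zero_iff τ z).1 h)
  set c := deriv s 0 / deriv (theta1 τ) 0
  have key : ∀ z ∉ (periods τ).lattice, s z / theta1 τ z = c := by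
    refine eq_of_doubly_periodic (periods τ) (fun z hz => (hs z).div (hθ z) (hne z hz))
      (fun z hz => ?_) (fun z hz => ?_) ?_
    · have h2 : cexp (-(π * I * (z + 1))) = -cexp (-(π * I * z)) := by
        rw [mul_add, mul_one, neg_add, Complex.exp_add, Complex.exp_neg (π * I),
          Complex.exp_pi_mul_I]
        norm_num
      rw [show (periods τ).ω₁ = 1 from rfl, theta1_add_one]
      simp only [hs_def]
      rw [thetaSeries_add_one, h2, neg_mul, neg_div_neg_eq]
    · have h2 : cexp (-(π * I * (z + τ))) * cexp (-(π * I * (2 * z + 1))) =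
          cexp (π * I - π * I * τ - 2 * π * I * z) * cexp (-(π * I * z)) := by
        rw [← Complex.exp_add, ← Complex.exp_add, Complex.exp_eq_exp_iff_exists_int]
        exact ⟨-1, by push_cast; ring⟩
      rw [show (periods τ).ω₂ = τ from rfl, theta1_add_tau]
      simp only [hs_def]
      rw [thetaSeries_add_tau, ← mul_assoc, h2, mul_assoc,
        mul_div_mul_left _ _ (Complex.exp_ne_zero _)]
    · have h := ((differentiable_dslope hs 0).continuous.continuousAt (x := 0)).div
        (differentiable_dslope hθ 0).continuous.continuousAt (by rwa [dslope_same])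
      have := h.tendsto
      simp only [Pi.div_apply, dslope_same] at this
      refine (this.mono_left nhdsWithin_le_nhds).congr' ?_
      filter_upwards [self_mem_nhdsWithin] with w hw
      rw [Pi.div_apply, eq_mul_dslope hs0 w, eq_mul_dslope (theta1_zero τ) w,
        mul_div_mul_left _ _ hw]
  have key2 : s = fun z => c * theta1 τ z :=
    eq_of_eq_off_lattice (periods τ) hs.continuous (hθ.continuous.const_mul c) fun z hz => by
      rw [← key z hz, div_mul_cancel₀ _ (hne z hz)]
  have hc : c ≠ 0 := by
    intro hc
    obtain ⟨z, hz⟩ := exists_thetaSeries_ne_zero τ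
    have := congrFun key2 z
    simp only [hc, zero_mul] at this
    exact mul_ne_zero (Complex.exp_ne_zero _) hz this
  refine ⟨c⁻¹, inv_ne_zero hc, fun z => ?_⟩
  have := congrFun key2 z
  simp only [hs_def] at this
  rw [mul_assoc, this, inv_mul_cancel_left₀ hc]

theorem deriv_mul_exp_mul {g : ℂ → ℂ} (hg : Differentiable ℂ g) (C : ℂ) :
    (deriv fun z => C * cexp (-(π * I * z)) * g z) =
      fun z => C * cexp (-(π * I * z)) * (deriv g z - π * I * g z) := by
  funext z
  have h : HasDerivAt (fun z => C * cexp (-(π * I * z))) (C * (cexp (-(π * I * z)) * -(π * I))) z := by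
    simpa using (((hasDerivAt_id' z).const_mul (π * I)).neg.cexp).const_mul C
  rw [(h.fun_mul (hg z).hasDerivAt).deriv]
  ring

/-- The analogue of `oddConst (theta1 τ)` in terms of `thetaSeries`. -/
def seriesConst (τ : ℍ) : ℂ :=
  (deriv (deriv (deriv (thetaSeries τ))) 0 - 3 * π * I * deriv (deriv (thetaSeries τ)) 0 +
    3 * (π * I) ^ 2 * deriv (thetaSeries τ) 0) * (3 * deriv (thetaSeries τ) 0)⁻¹

theorem deriv_thetaSeries_zero_ne_zero (τ : ℍ) : deriv (thetaSeries τ) 0 ≠ 0 := by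
  obtain ⟨C, -, h⟩ := exists_theta1_eq τ
  have ha := deriv_theta1_zero_ne_zero τ
  rw [funext h, deriv_mul_exp_mul (differentiable_thetaSeries τ)] at ha
  intro h0
  simp [h0, thetaSeries_zero] at ha

/-- The closed formula has degree zero in `θ₁`, so `C` cancels. The factor `exp (-πiz)` multiplies
`hirota` by its square `y⁻¹` and alters only the constant, to `seriesConst`. -/
theorem regularizedEllipticGenus_eq_thetaSeries (r : ℕ) (hr : 1 ≤ r) (τ : ℍ) (z : ℂ) :
    regularizedEllipticGenus r τ z = -r * (cexp (2 * π * I * z) ^ (-1 : ℤ) *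
      (hirota (thetaSeries τ) z - seriesConst τ * (thetaSeries τ z * thetaSeries τ z)) *
        ((deriv (thetaSeries τ) 0)⁻¹ * (deriv (thetaSeries τ) 0)⁻¹)) := by
  obtain ⟨C, hC, h⟩ := exists_theta1_eq τ
  have hS := differentiable_thetaSeries τ
  have hS1 := differentiable_deriv hS
  have hS2 := differentiable_deriv hS1
  have ha := deriv_thetaSeries_zero_ne_zero τ
  have hE : cexp (2 * π * I * z) ^ (-1 : ℤ) = cexp (-(π * I * z)) ^ 2 := by
    rw [zpow_neg_one, ← Complex.exp_neg, ← Complex.exp_nat_mul]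
    congr 1
    push_cast
    ring
  have d1 : deriv (theta1 τ) = fun z => C * cexp (-(π * I * z)) *
      (deriv (thetaSeries τ) z - π * I * thetaSeries τ z) := by
    rw [funext h, deriv_mul_exp_mul hS]
  have d2 : deriv (deriv (theta1 τ)) = fun z => C * cexp (-(π * I * z)) *
      (deriv (deriv (thetaSeries τ)) z - 2 * (π * I) * deriv (thetaSeries τ) z +
        (π * I) ^ 2 * thetaSeries τ z) := by
    rw [d1, deriv_mul_exp_mul (hS1.fun_sub (hS.const_mul _))]
    funext z
    rw [((hS1 z).hasDerivAt.fun_sub ((hS z).hasDerivAt.const_mul (π * I))).deriv]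
    ring
  have d3 : deriv (deriv (deriv (theta1 τ))) = fun z => C * cexp (-(π * I * z)) *
      (deriv (deriv (deriv (thetaSeries τ))) z - 3 * (π * I) * deriv (deriv (thetaSeries τ)) z +
        3 * (π * I) ^ 2 * deriv (thetaSeries τ) z - (π * I) ^ 3 * thetaSeries τ z) := by
    rw [d2, deriv_mul_exp_mul
      ((hS2.fun_sub (hS1.const_mul _)).fun_add (hS.const_mul _))]
    funext z
    rw [(((hS2 z).hasDerivAt.fun_sub ((hS1 z).hasDerivAt.const_mul (2 * (π * I)))).fun_add
      ((hS z).hasDerivAt.const_mul ((π * I) ^ 2))).deriv]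
    ring
  rw [regularizedEllipticGenus_eq r hr, hE, hirota, hirota, oddConst, seriesConst, d3, d2, d1, h]
  simp only [thetaSeries_zero, mul_zero, neg_zero, Complex.exp_zero, mul_one, sub_zero]
  generalize cexp (-(π * I * z)) = E
  generalize thetaSeries τ z = S at *
  generalize deriv (thetaSeries τ) z = S₁
  generalize deriv (deriv (thetaSeries τ)) z = S₂
  generalize deriv (thetaSeries τ) 0 = A at *
  field_simp
  ring

theorem isFourier_regularizedEllipticGenus (r : ℕ) (hr : 1 ≤ r) :
    IsFourier (regularizedEllipticGenus r) := by
  have h0 := hasFourier_thetaSeries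
  have h1 := h0.deriv
  have h2 := h1.deriv
  have h3 := h2.deriv
  set G₁ := zeroSeries fun p => 2 * π * I * p.2 * thetaCoeff p
  have hG₁ : ∀ q ∈ Metric.ball (0 : ℂ) 1, G₁ q ≠ 0 := fun q hq => by
    rcases eq_or_ne q 0 with rfl | hq0
    -- At `q = 0` only `l = 0, 1` occur in the theta series, and differentiation kills `l = 0`.
    · have : G₁ 0 = -(2 * π * I) := by
        refine (tsum_eq_single (0, 1) ?_).trans (by simp [thetaCoeff])
        rintro ⟨n, l⟩ hp
        rcases Nat.eq_zero_or_pos n with rfl | hn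
        · rcases eq_or_ne l 0 with rfl | hl
          · simp
          · have : l - 1 ≠ 0 := fun h => hp (by
              rw [sub_eq_zero.1 h])
            simp [thetaCoeff, hl, this]
        · simp [hn.ne']
      rw [this]
      exact neg_ne_zero.2 Complex.two_pi_I_ne_zero
    -- For `q ≠ 0`, the value is the derivative at `z = 0` for some `τ`, nonzero because that of
    -- `θ₁` is.
    · obtain ⟨τ, rfl⟩ := exists_exp_eq hq0 (mem_ball_zero_iff.1 hq)
      rw [show G₁ _ = _ from (h1.apply_zero τ).symm]
      exact deriv_thetaSeries_zero_ne_zero τ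
  have d1 := h1.differentiableOn_zeroSeries
  have d2 := h2.differentiableOn_zeroSeries
  have d3 := h3.differentiableOn_zeroSeries
  have hinv := isFourier_of_differentiableOn (d1.inv hG₁)
  have hconst := isFourier_of_differentiableOn
    ((((d3.sub (d2.const_mul (3 * π * I))).add (d1.const_mul (3 * (π * I) ^ 2))).mul
      ((d1.const_mul 3).inv fun q hq => mul_ne_zero three_ne_zero (hG₁ q hq))))
  have F0 : IsFourier thetaSeries := ⟨_, h0⟩
  have F1 : IsFourier fun τ => deriv (thetaSeries τ) := ⟨_, h1⟩
  have F2 : IsFourier fun τ => deriv (deriv (thetaSeries τ)) := ⟨_, h2⟩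
  have := ((((isFourier_exp_zpow (-1)).mul (((F0.mul F2).sub (F1.mul F1)).sub
    (hconst.mul (F0.mul F0)))).mul (hinv.mul hinv)).const_mul (-r))
  convert! this using 3 with τ z
  rw [regularizedEllipticGenus_eq_thetaSeries r hr]
  simp only [Pi.mul_apply, Pi.inv_apply, Pi.add_apply, Pi.sub_apply, hirota, seriesConst,
    ← h1.apply_zero, ← h2.apply_zero, ← h3.apply_zero, sq (deriv (thetaSeries τ) z)]

end ThetaSeries

theorem isWeakJacobiForm_regularizedEllipticGenus (r : ℕ) (hr : 1 ≤ r) :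
    IsWeakJacobiForm 0 1 (regularizedEllipticGenus r) := by
  obtain ⟨c, hc⟩ := isFourier_regularizedEllipticGenus r hr
  refine ⟨fun x hx => (hc.differentiableAt hx).differentiableWithinAt, fun γ τ z => ?_,
    fun a b τ z => ?_, fun n l => c (n, l), hc⟩
  · rw [zpow_zero, one_mul, Nat.cast_one, mul_one]
    exact regularizedEllipticGenus_modular γ τ r hr z
  · rw [Nat.cast_one, mul_one]
    exact regularizedEllipticGenus_elliptic r hr a b τ z

end ALEGenus

end

theorem mainTheorem1 (r : ℕ) (hr : 1 ≤ r) :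
    (∀ (τ : ℍ) (z : ℂ),
      Tendsto
        (fun t : ℂ => ALEGenus.equivariantEllipticGenus r τ z t (-t) -
          ALEGenus.singularTerm r τ z t)
        (𝓝[≠] (0 : ℂ)) (𝓝 (ALEGenus.regularizedEllipticGenus r τ z))) ∧
    (∀ (τ : ℍ) (z : ℂ), z ∉ (ALEGenus.periods τ).lattice →
      ALEGenus.regularizedEllipticGenus r τ z =
        (r : ℂ) / (2 * (π : ℂ)) ^ 2 *
          (ALEGenus.theta1 τ z / ModularForm.eta (τ : ℂ) ^ 3) ^ 2 *
            (ALEGenus.periods τ).weierstrassP z) ∧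
    ALEGenus.IsWeakJacobiForm 0 1 (ALEGenus.regularizedEllipticGenus r) ∧
    (∀ (τ : ℍ) (z : ℂ),
      ALEGenus.regularizedEllipticGenus r τ z =
        (r : ℂ) / 24 * ALEGenus.ellipticGenusK3 τ z) := by
  refine ⟨fun τ z => ?_, fun τ z hz => ALEGenus.regularizedEllipticGenus_eq_weierstrassP r hr τ z hz,
    ALEGenus.isWeakJacobiForm_regularizedEllipticGenus r hr,
    ALEGenus.regularizedEllipticGenus_eq_K3 r hr⟩
  rw [ALEGenus.regularizedEllipticGenus_eq r hr]
  exact ALEGenus.tendsto_equivariantEllipticGenus r hr τ z
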